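/- Let $\beta>1$ be a Pisot number, i.e. a real algebraic integer all of whose other conjugates have modulus $<1$. Let $T(x)=\beta x-\lfloor\beta x\rfloor$; the $\beta$-expansion $d_\beta(x)=u_1u_2\cdots$ of $x\in[0,1]$ has digits $u_i=\lfloor\beta T^{i-1}(x)\rfloor$. Let $\Pi_\beta$ be the set of $x\in[0,1)$ with purely periodic $\beta$-expansion. Let $N(\beta)$ be the norm of $\beta$ from $\mathbb Q(\beta)$ to $\mathbb Q$, let $\mathbb Z_{(N(\beta))}=\{p/q:\ p,q\in\mathbb Z,\ q\neq 0,\ \gcd(q,N(\beta))=1\}$, and $$\gamma(\beta)=\sup\{v\in[0,1]:\ \text{every } x\in\mathbb Z_{(N(\beta))}\text{ with }0<x\le v\text{ lies in }\Pi_\beta\}.$$ Put $d^*_\beta(1)=d_\beta(1)$ if $d_\beta(1)$ is infinite, and $d^*_\beta(1)=(u_1\cdots u_{N-1}(u_N-1))^\infty$ if $d_\beta(1)=u_1\cdots u_N0^\infty$ with $u_N\ne0$. Write $d_\beta^*(1)=t_1\cdots t_m(t_{m+1}\cdots t_n)^\infty$ with $m$ the minimal preperiod length and $n-m$ the minimal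 period length. A finite string $w$ of digits in $\{0,\dots,\lceil\beta\rceil-1\}$ is admissible if every shift of $w0^\infty$ is lexicographically smaller than $d_\beta^*(1)$. The admissibility graph has nodes $1,\dots,n$; from each node $b$ there are $t_b$ edges to node $1$, labelled $0,\dots,t_b-1$, and one edge labelled $t_b$, which goes to $b+1$ if $b<n$ and to $m+1$ if $b=n$. Let $\mathcal L^{(a)}$ be the set of admissible strings which this graph conducts from node $1$ to node $a$. Let $\mathbb K_\infty\simeq\mathbb R^{r-1}\times\mathbb C^s$ be the product of the Archimedean completions of $\mathbb Q(\beta)$ other than the one given by the inclusion in $\mathbb R$, let $\mathbb K_f$ be the product of the completions of $\mathbb Q(\beta)$ at the prime ideals of its ring of integers that contain $\beta$, and let $\phi_\infty$, $\phi_f$ and $\phi_\beta=(\phi_\infty,\phi_f)$ be the natural embeddings of $\mathbb Q(\beta)$ in $\mathbb K_\infty$, $\mathbb K_f$ and $\mathbb K_\infty\times\mathbb K_f$. For $A\subset\mathbb R$ let $\Delta_\infty(A)=\{(x,\dots,x):x\in A\}\subset\mathbb K_\infty$. Let $\widetilde{\mathcal T}$ (resp. $\widetilde{\mathcal T}^{(a)}$,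 $1\le a\le n$) be the closure of the set of all $\phi_\beta(w_p\beta^p+\cdots+w_0)$ with $w_p\cdots w_0$ admissible (resp. $w_p\cdots w_0\in\mathcal L^{(a)}$). Put $F=\overline{\phi_f(\mathbb Z_{(N(\beta))})}$. The numbers $T^{a-1}(1)$, $1\le a\le n$, are pairwise distinct, so $\{1,\dots,n\}=\{a_1,\dots,a_n\}$ with $\theta_k:=T^{a_k-1}(1)$ strictly increasing in $k$; put $\theta_0:=0$. Then, for $1\le k\le n$: 1. $\gamma(\beta)\ge\theta_k$ if and only if $$\gamma(\beta)\ge\theta_{k-1}\quad\text{and}\quad\Delta_\infty([\theta_{k-1},\theta_k])\times F\subset\bigcup_{j=k}^n(-\widetilde{\mathcal T}^{(a_j)}).$$ 2. If $\theta_{k-1}<\gamma(\beta)\le\theta_k$, then $$\gamma(\beta)=\sup\Big\{\eta\in[\theta_{k-1},\theta_k]:\ \Delta_\infty([\theta_{k-1},\eta])\times F\subset\bigcup_{j=k}^n(-\widetilde{\mathcal T}^{(a_j)})\Big\};$$ if moreover $\gamma(\beta)<\theta_k$, the restriction $\eta\le\theta_k$ may be omitted. Finally, if $-\widetilde{\mathcal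 T}$ does not contain $\Delta_\infty([0,\eta])\times F$ for any $\eta>0$, then $\gamma(\beta)=0$. -/

import Mathlib

open scoped NumberField Pointwise

namespace PisotBeta

/-! ### Pisot numbers, the beta-transformation and beta-expansions -/

/-- A Pisot number: a real algebraic integer `β > 1` all of whose other conjugates lie in the open
unit disc. -/
structure IsPisot (β : ℝ) : Prop where
  isIntegral : IsIntegral ℤ β
  one_lt : 1 < β
  norm_conj_lt_one : ∀ z : ℂ, Polynomial.aeval z (minpoly ℚ β) = 0 → z ≠ (β : ℂ) → ‖z‖ < 1

/-- The beta-transformation `x ↦ β x mod 1`. -/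
noncomputable def T (β x : ℝ) : ℝ := Int.fract (β * x)

/-- The digits of the beta-expansion of `x`, numbered from `0`:
`digit β x i` is the usual `u_{i+1} = ⌊β T^i x⌋`. -/
noncomputable def digit (β x : ℝ) (i : ℕ) : ℕ := ⌊β * (T β)^[i] x⌋₊

/-- The reals in `[0,1)` with purely periodic beta-expansion. -/
def purelyPeriodic (β : ℝ) : Set ℝ :=
  {x | x ∈ Set.Ico (0 : ℝ) 1 ∧ ∃ l : ℕ, 0 < l ∧ ∀ i, digit β x (i + l) = digit β x i}

open Classical in
/-- The sequence `d*_β(1) = t_1 t_2 …`, with `dstar β i = t_{i+1}`. It is the expansion `d_β(1)` if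
that is infinite, and `(u_1 … u_{N-1} (u_N - 1))^∞` if `d_β(1) = u_1 … u_N 0^∞` with `u_N ≠ 0`
(the least index from which all digits vanish is `N`). -/
noncomputable def dstar (β : ℝ) (i : ℕ) : ℕ :=
  if h : ∃ N, ∀ j, N ≤ j → digit β 1 j = 0 then
    if i % Nat.find h = Nat.find h - 1 then digit β 1 (i % Nat.find h) - 1
    else digit β 1 (i % Nat.find h)
  else digit β 1 i

/-- The length `m` of the preperiod of `d*_β(1)`. -/
noncomputable def preperiod (β : ℝ) : ℕ :=
  sInf {m | ∃ p, 0 < p ∧ ∀ i, m ≤ i → dstar β (i + p) = dstar β i}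

/-- The length of the (least) period of `d*_β(1)`. -/
noncomputable def period (β : ℝ) : ℕ :=
  sInf {p | 0 < p ∧ ∀ i, preperiod β ≤ i → dstar β (i + p) = dstar β i}

/-- `n`, the sum of the lengths of the preperiod and of the period of `d*_β(1)`. The alphabet of
nodes is `{1, …, n}`. -/
noncomputable def size (β : ℝ) : ℕ := preperiod β + period β

/-- Strict lexicographic order on digit sequences. -/
def LexLT (u v : ℕ → ℕ) : Prop := ∃ k, (∀ i, i < k → u i = v i) ∧ u k < v k

/-- Admissible finite strings `w` (most significant digit first): the digits are in
`{0, …, ⌈β⌉ - 1}` and every shift of `w 0^∞` is lexicographically smaller than `d*_β(1)`. -/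
def Admissible (β : ℝ) (w : List ℕ) : Prop :=
  (∀ d ∈ w, d < ⌈β⌉₊) ∧ ∀ k : ℕ, LexLT (fun i => w.getD (k + i) 0) (dstar β)

/-- `Edge β b ε a`: the admissibility graph has an edge `b → a` labelled `ε`. From each node `b`
there are edges to `1` labelled `0, …, t_b - 1`, and one edge labelled `t_b`, to `b + 1` if `b < n`
and to `m + 1` if `b = n`. -/
def Edge (β : ℝ) (b ε a : ℕ) : Prop :=
  b ∈ Set.Icc 1 (size β) ∧
    ((ε < dstar β (b - 1) ∧ a = 1) ∨
     (ε = dstar β (b - 1) ∧ b < size β ∧ a = b + 1) ∨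
     (ε = dstar β (b - 1) ∧ b = size β ∧ a = preperiod β + 1))

/-- `Leads β b w a`: reading the string `w` in the admissibility graph from `b` ends at `a`. -/
inductive Leads (β : ℝ) : ℕ → List ℕ → ℕ → Prop
  | nil (a : ℕ) : Leads β a [] a
  | cons {b c a ε : ℕ} {w : List ℕ} (h : Edge β b ε c) (h' : Leads β c w a) :
      Leads β b (ε :: w) a

/-- The admissible strings which the admissibility graph conducts from the node `1` to `a`. -/
def language (β : ℝ) (a : ℕ) : Set (List ℕ) := {w | Admissible β w ∧ Leads β 1 w a}

/-- `a_1, …, a_n` is the relabelling of the nodes `1, …, n` for which the numbers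
`T^{a_k - 1}(1)` are strictly increasing in `k`. -/
structure IsOrbitOrdering (β : ℝ) (a : ℕ → ℕ) : Prop where
  bijOn : Set.BijOn a (Set.Icc 1 (size β)) (Set.Icc 1 (size β))
  strictMonoOn : StrictMonoOn (fun k => (T β)^[a k - 1] 1) (Set.Icc 1 (size β))

/-- The number `T^{a_k - 1}(1)`, which is `0` for `k = 0` by convention. -/
noncomputable def level (β : ℝ) (a : ℕ → ℕ) (k : ℕ) : ℝ :=
  if k = 0 then 0 else (T β)^[a k - 1] 1

/-! ### The field `ℚ(β)` and the complete representation space -/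

/-- The field `ℚ(β)`, as a subfield of `ℝ`. -/
abbrev BetaField (β : ℝ) : Type := IntermediateField.adjoin ℚ ({β} : Set ℝ)

/-- `β` as an element of `ℚ(β)`. -/
noncomputable def gen (β : ℝ) : BetaField β := IntermediateField.AdjoinSimple.gen ℚ β

instance (β : ℝ) [hβ : Fact (IsPisot β)] : NumberField (BetaField β) where
  to_charZero := inferInstance
  to_finiteDimensional :=
    IntermediateField.adjoin.finiteDimensional (hβ.out.isIntegral.tower_top (A := ℚ))

theorem isIntegral_gen (β : ℝ) [hβ : Fact (IsPisot β)] : IsIntegral ℤ (gen β) := by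
  have h : IsIntegral ℤ (algebraMap (BetaField β) ℝ (gen β)) := by
    simpa [gen] using hβ.out.isIntegral
  exact (isIntegral_algebraMap_iff (algebraMap (BetaField β) ℝ).injective).1 h

/-- `β` as an element of the ring of integers of `ℚ(β)`. -/
noncomputable def genInt (β : ℝ) [Fact (IsPisot β)] : 𝓞 (BetaField β) := ⟨gen β, isIntegral_gen β⟩

/-- The norm `N(β)`. -/
noncomputable def normBeta (β : ℝ) [Fact (IsPisot β)] : ℤ := Algebra.norm ℤ (genInt β)

/-- `ℤ_(N(β))`: the rational numbers `p / q` with `gcd(q, N(β)) = 1`. -/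
def ZN (β : ℝ) [Fact (IsPisot β)] : Set ℚ := {x | Int.gcd x.den (normBeta β) = 1}

/-- The function `γ`. -/
noncomputable def gamma (β : ℝ) [Fact (IsPisot β)] : ℝ :=
  sSup {v : ℝ | v ∈ Set.Icc (0 : ℝ) 1 ∧
    ∀ x : ℚ, 0 < x → (x : ℝ) ≤ v → x ∈ ZN β → (x : ℝ) ∈ purelyPeriodic β}

/-- The real embeddings of `ℚ(β)` other than the inclusion in `ℝ`. -/
abbrev RealConj (β : ℝ) : Type := {τ : BetaField β →+* ℝ // τ ≠ algebraMap (BetaField β) ℝ}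

/-- The non-real complex embeddings of `ℚ(β)`, one out of each pair of complex conjugates: the one
that sends `β` to the upper half plane. -/
abbrev ComplexConj (β : ℝ) : Type := {τ : BetaField β →+* ℂ // 0 < (τ (gen β)).im}

/-- The Euclidean representation space `K_∞ = ℝ^{r-1} × ℂ^s`. -/
abbrev KInf (β : ℝ) : Type := (RealConj β → ℝ) × (ComplexConj β → ℂ)

/-- The embedding `φ_∞`. -/
noncomputable def phiInf (β : ℝ) (x : BetaField β) : KInf β := (fun τ => τ.1 x, fun τ => τ.1 x)

/-- The diagonal point `Δ_∞(t) = (t, …, t)`. -/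
noncomputable def diag (β : ℝ) (t : ℝ) : KInf β := (fun _ => t, fun _ => (t : ℂ))

/-- The prime ideals of the ring of integers of `ℚ(β)` which contain `β`. -/
abbrev PrimesAbove (β : ℝ) [Fact (IsPisot β)] : Type :=
  {P : IsDedekindDomain.HeightOneSpectrum (𝓞 (BetaField β)) // genInt β ∈ P.asIdeal}

/-- `K_f`, the product of the completions of `ℚ(β)` at the prime ideals which contain `β`. -/
abbrev KFin (β : ℝ) [Fact (IsPisot β)] : Type :=
  (P : PrimesAbove β) → P.1.adicCompletion (BetaField β)

/-- The embedding `φ_f`. -/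
noncomputable def phiFin (β : ℝ) [Fact (IsPisot β)] (x : BetaField β) : KFin β :=
  fun P => algebraMap (BetaField β) (P.1.adicCompletion (BetaField β)) x

/-- The complete representation space `K_β = K_∞ × K_f`. -/
abbrev KBeta (β : ℝ) [Fact (IsPisot β)] : Type := KInf β × KFin β

/-- The embedding `φ_β`. -/
noncomputable def phi (β : ℝ) [Fact (IsPisot β)] (x : BetaField β) : KBeta β :=
  (phiInf β x, phiFin β x)

/-! ### Tiles and stripes -/

/-- The number `w_p β^p + … + w_0` for a string `w = w_p … w_0`. -/
noncomputable def value (β : ℝ) (w : List ℕ) : BetaField β := Nat.ofDigits (gen β) w.reverse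

/-- The set `Int(β)` of integers in base `β`. -/
noncomputable def betaInt (β : ℝ) : Set (BetaField β) := value β '' {w | Admissible β w}

/-- The complete central tile. -/
noncomputable def tile (β : ℝ) [Fact (IsPisot β)] : Set (KBeta β) := closure (phi β '' betaInt β)

/-- The complete central subtile of the node `a`: the closure of the image of the integers in base
`β` whose expansion is in the language of `a`. Leading zeros in a string change neither its value
nor the node to which it leads, since `0` labels a loop at the node `1`. -/
noncomputable def subtile (β : ℝ) [Fact (IsPisot β)] (a : ℕ) : Set (KBeta β) :=
  closure (phi β '' (value β '' language β a))

/-- The stripe `Δ_∞([s, t]) × closure (φ_f (ℤ_(N(β))))`. -/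
noncomputable def stripe (β : ℝ) [Fact (IsPisot β)] (s t : ℝ) : Set (KBeta β) :=
  (diag β '' Set.Icc s t) ×ˢ closure ((fun x : ℚ => phiFin β (x : BetaField β)) '' ZN β)

/-- The union of the sets `-T̃^(a_j)` for `k ≤ j ≤ n`. -/
noncomputable def negSubtiles (β : ℝ) [Fact (IsPisot β)] (a : ℕ → ℕ) (k : ℕ) : Set (KBeta β) :=
  ⋃ j ∈ Set.Icc k (size β), -subtile β (a j)

end PisotBeta

/-!
For `z ∈ ℚ(β) ∩ [0, 1)` the beta-expansion is purely periodic if and only if there is a node `a`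
such that `z < T^{a-1}(1)` and `-φ_β(z) ∈ T̃^(a)`. Indeed, an edge `b → a` labelled `ε` leads from
such a `z` back to its preimage `(z + ε) / β` under `T`, with node `b`; since tiles are bounded,
these backward steps stay in a finite set of numbers with bounded conjugates and denominators, which
`T` maps onto itself, and hence permutes. Conversely, if `T^l(z) = z`, then the first `l j` digits
of `z` form an admissible string of value `β^{lj} z - z`, and `φ_β(β^{lj})` tends to `0`.

The rationals of `ℤ_(N(β))` in an interval are mapped to a dense subset of the corresponding stripe:
`N / (N + 1)` with `N = |N(β)|` has absolute value less than `1` both in `ℝ` and at the primes which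
contain `β`, so adding to `y ∈ ℤ_(N(β))` integer multiples of its high powers approximates any real
number while `φ_f(y)` hardly changes. As the subtiles are closed, all the rationals of `ℤ_(N(β))`
between two consecutive numbers `θ_{k-1} < θ_k` are purely periodic exactly if the stripe between
them is covered by the sets `-T̃^(a_k), …, -T̃^(a_n)`.
-/

namespace PisotBeta

open Filter Function Set Topology
open IsDedekindDomain (HeightOneSpectrum)

/-! ### Finite sets -/

theorem mem_periodicPts_of_surjOn {α : Type*} {f : α → α} {s : Set α} (hs : s.Finite)
    (hf : SurjOn f s s) {x : α} (hx : x ∈ s) : x ∈ periodicPts f := by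
  have himage : s = f '' s := eq_of_subset_of_ncard_le hf (ncard_image_le hs) (hs.image f)
  have hmaps : MapsTo f s s := mapsTo_iff_image_subset.2 himage.ge
  have hinj : InjOn f s := ((hs.surjOn_iff_bijOn_of_mapsTo hmaps).1 hf).injOn
  have := hs.to_subtype
  obtain ⟨l, hl, hper⟩ := (hmaps.restrict_inj.2 hinj).mem_periodicPts ⟨x, hx⟩
  exact ⟨l, hl, hper.map (g := Subtype.val) fun _ => rfl⟩

theorem exists_bijOn_strictMonoOn_comp {ι α : Type*} [LinearOrder ι] [LinearOrder α] {f : ι → α}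
    {s : Finset ι} (hf : InjOn f s) :
    ∃ a : ι → ι, BijOn a s s ∧ StrictMonoOn (f ∘ a) s := by
  let e : s ≃o s.image f :=
    (s.orderIsoOfFin rfl).symm.trans ((s.image f).orderIsoOfFin (Finset.card_image_of_injOn hf))
  have hex : ∀ x, ∃ y, ∀ hx : x ∈ s, y ∈ s ∧ f y = e ⟨x, hx⟩ := fun x => by
    by_cases hx : x ∈ s
    · obtain ⟨y, hy, hfy⟩ := Finset.mem_image.1 (e ⟨x, hx⟩).2
      exact ⟨y, fun _ => ⟨hy, hfy⟩⟩
    · exact ⟨x, fun h => absurd h hx⟩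
  choose a ha using hex
  have hmono : StrictMonoOn (f ∘ a) s := fun x hx y hy hxy => by
    rw [comp_apply, comp_apply, (ha x hx).2, (ha y hy).2]
    exact e.strictMono (Subtype.mk_lt_mk.2 hxy)
  have hmaps : MapsTo a s s := fun x hx => (ha x hx).1
  have hinj : InjOn a s := hmono.injOn.of_comp
  exact ⟨a, ⟨hmaps, hinj, Finset.surjOn_of_injOn_of_card_le a hmaps hinj le_rfl⟩, hmono⟩

/-! ### Digits and remainders -/

/-- The numbers `u i ∈ [0,1]` are the successive remainders of an expansion of `u 0` in base `β`
with digits `d 0, d 1, …`. Allowing the remainder `1` covers quasi-greedy expansions as well as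
greedy ones. -/
structure IsRemainderSeq (β : ℝ) (d : ℕ → ℕ) (u : ℕ → ℝ) : Prop where
  mem_Icc : ∀ i, u i ∈ Icc (0 : ℝ) 1
  mul_eq : ∀ i, β * u i = d i + u (i + 1)

namespace IsRemainderSeq

variable {β : ℝ} {d e : ℕ → ℕ} {u v : ℕ → ℝ}

theorem shift (hu : IsRemainderSeq β d u) (k : ℕ) :
    IsRemainderSeq β (fun i => d (k + i)) fun i => u (k + i) :=
  ⟨fun _ => hu.mem_Icc _, fun _ => hu.mul_eq _⟩

theorem digit_le_mul (hu : IsRemainderSeq β d u) (i : ℕ) : (d i : ℝ) ≤ β * u i := by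
  linarith [hu.mul_eq i, (hu.mem_Icc (i + 1)).1]

theorem sub_eq_pow_mul_sub (hu : IsRemainderSeq β d u) (hv : IsRemainderSeq β d v) (k : ℕ) :
    u k - v k = β ^ k * (u 0 - v 0) := by
  induction k with
  | zero => simp
  | succ k ih =>
    rw [pow_succ', mul_assoc, ← ih]
    linarith [hu.mul_eq k, hv.mul_eq k]

theorem apply_zero_eq (hβ : 1 < β) (hu : IsRemainderSeq β d u) (hv : IsRemainderSeq β d v) :
    u 0 = v 0 := by
  by_contra hne
  have hpos : 0 < |u 0 - v 0| := abs_pos.2 (sub_ne_zero.2 hne)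
  obtain ⟨k, hk⟩ := pow_unbounded_of_one_lt (1 / |u 0 - v 0|) hβ
  have hle : |u k - v k| ≤ 1 := Real.dist_le_of_mem_Icc_01 (hu.mem_Icc k) (hv.mem_Icc k)
  rw [hu.sub_eq_pow_mul_sub hv, abs_mul, abs_of_pos (pow_pos (by linarith) k)] at hle
  rw [div_lt_iff₀ hpos] at hk
  linarith

theorem digit_le_of_lt (hβ : 0 < β) (hu : IsRemainderSeq β d u) (hv : IsRemainderSeq β e v)
    {i j : ℕ} (h : u i < v j) : d i ≤ e j := by
  have hmul : β * u i < β * v j := mul_lt_mul_of_pos_left h hβ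
  have : (d i : ℝ) < e j + 1 := by
    linarith [hu.digit_le_mul i, hv.mul_eq j, (hv.mem_Icc (j + 1)).2]
  exact Nat.lt_succ_iff.1 (by exact_mod_cast this)

theorem succ_lt_succ (hβ : 0 < β) (hu : IsRemainderSeq β d u) (hv : IsRemainderSeq β e v)
    {i j : ℕ} (h : u i < v j) (hd : d i = e j) : u (i + 1) < v (j + 1) := by
  have hmul : β * u i < β * v j := mul_lt_mul_of_pos_left h hβ
  rw [hu.mul_eq, hv.mul_eq, hd] at hmul
  linarith

theorem lexLT (hβ : 1 < β) (hu : IsRemainderSeq β d u) (hv : IsRemainderSeq β e v)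
    (h : u 0 < v 0) : LexLT d e := by
  have hβ0 : 0 < β := by linarith
  rcases lt_trichotomy (toLex d) (toLex e) with hlt | heq | ⟨k, heq, hlt⟩
  · exact hlt
  · rw [toLex.injective heq] at hu
    exact absurd (hu.apply_zero_eq hβ hv) h.ne
  · have hrem : ∀ i ≤ k, u i < v i := fun i hi => by
      induction i with
      | zero => exact h
      | succ i ih => exact succ_lt_succ hβ0 hu hv (ih (by omega)) (heq i (by simpa using hi)).symm
    exact absurd (hu.digit_le_of_lt hβ0 hv (hrem k le_rfl)) hlt.not_ge

end IsRemainderSeq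

/-! ### The beta-transformation -/

theorem T_iterate_succ (β x : ℝ) (i : ℕ) : (T β)^[i + 1] x = Int.fract (β * (T β)^[i] x) :=
  iterate_succ_apply' _ _ _

theorem T_iterate_mem_Ico (β : ℝ) {x : ℝ} (hx : x ∈ Ico (0 : ℝ) 1) (i : ℕ) :
    (T β)^[i] x ∈ Ico (0 : ℝ) 1 :=
  (show MapsTo (T β) (Ico 0 1) (Ico 0 1) from
    fun _ _ => ⟨Int.fract_nonneg _, Int.fract_lt_one _⟩).iterate i hx

theorem T_iterate_mem_Icc (β : ℝ) {x : ℝ} (hx : x ∈ Icc (0 : ℝ) 1) (i : ℕ) :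
    (T β)^[i] x ∈ Icc (0 : ℝ) 1 :=
  (show MapsTo (T β) (Icc 0 1) (Icc 0 1) from
    fun _ _ => ⟨Int.fract_nonneg _, (Int.fract_lt_one _).le⟩).iterate i hx

theorem isRemainderSeq_T_iterate {β x : ℝ} (hβ : 0 ≤ β) (hx : x ∈ Icc (0 : ℝ) 1) :
    IsRemainderSeq β (digit β x) fun i => (T β)^[i] x where
  mem_Icc := T_iterate_mem_Icc β hx
  mul_eq i := by
    rw [T_iterate_succ, digit,
      natCast_floor_eq_intCast_floor (mul_nonneg hβ (T_iterate_mem_Icc β hx i).1),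
      Int.floor_add_fract]

theorem digit_T_iterate (β x : ℝ) (k i : ℕ) : digit β ((T β)^[k] x) i = digit β x (k + i) := by
  rw [digit, digit, ← iterate_add_apply, add_comm]

theorem T_iterate_eq_zero_of_le {β x : ℝ} {N j : ℕ} (h : (T β)^[N] x = 0) (hj : N ≤ j) :
    (T β)^[j] x = 0 := by
  have hfixed : T β 0 = 0 := by simp [T]
  obtain ⟨k, rfl⟩ := Nat.exists_eq_add_of_le' hj
  rw [iterate_add_apply, h, iterate_fixed hfixed]

theorem T_iterate_eq_zero_iff {β x : ℝ} (hβ : 1 < β) (hx : x ∈ Icc (0 : ℝ) 1) (N : ℕ) :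
    (T β)^[N] x = 0 ↔ ∀ j, N ≤ j → digit β x j = 0 := by
  refine ⟨fun h j hj => by simp [digit, T_iterate_eq_zero_of_le h hj], fun h => ?_⟩
  have hN := (isRemainderSeq_T_iterate (by linarith) hx).shift (β := β) N
  have hzero : IsRemainderSeq β (fun i => digit β x (N + i)) fun _ => 0 :=
    ⟨by simp, fun i => by simp [h]⟩
  exact hN.apply_zero_eq hβ hzero

theorem mem_purelyPeriodic_iff {β x : ℝ} (hβ : 1 < β) (hx : x ∈ Ico (0 : ℝ) 1) :
    x ∈ purelyPeriodic β ↔ x ∈ periodicPts (T β) := by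
  refine ⟨fun ⟨_, l, hl, h⟩ => ⟨l, hl, ?_⟩, fun ⟨l, hl, h⟩ => ⟨hx, l, hl, fun i => ?_⟩⟩
  · have hrem := isRemainderSeq_T_iterate (by linarith : 0 ≤ β) (Ico_subset_Icc_self hx)
    have hshift := hrem.shift l
    simp only [add_comm l, h] at hshift
    rw [IsPeriodicPt, IsFixedPt, ← zero_add l]
    exact hshift.apply_zero_eq hβ hrem
  · rw [digit, digit, iterate_add_apply, h]

/-! ### The quasi-greedy orbit of `1` -/

/-- The quasi-greedy transformation: it agrees with `T` except that it takes the value `1` where `T`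
takes the value `0`. Its digits along the orbit of `1` form `d*_β(1)`. -/
noncomputable def quasiT (β x : ℝ) : ℝ := β * x - (⌈β * x⌉ - 1)

/-- The orbit of `1` under the quasi-greedy transformation. -/
noncomputable def quasiOrbit (β : ℝ) (i : ℕ) : ℝ := (quasiT β)^[i] 1

theorem quasiT_mem_Ioc (β x : ℝ) : quasiT β x ∈ Ioc (0 : ℝ) 1 :=
  ⟨by linarith [Int.ceil_lt_add_one (β * x), quasiT.eq_1 β x],
    by linarith [Int.le_ceil (β * x), quasiT.eq_1 β x]⟩

theorem quasiT_of_T_eq_zero {β x : ℝ} (h : T β x = 0) : quasiT β x = 1 := by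
  obtain ⟨n, hn⟩ := Int.fract_eq_zero_iff.1 h
  simp [quasiT, ← hn]

theorem quasiT_of_T_ne_zero {β x : ℝ} (h : T β x ≠ 0) : quasiT β x = T β x := by
  rw [quasiT, (Int.ceil_eq_floor_add_one_iff_notMem _).2 (mt Int.fract_eq_zero_iff.2 h), T,
    ← Int.self_sub_floor]
  push_cast
  ring

theorem quasiOrbit_zero (β : ℝ) : quasiOrbit β 0 = 1 := rfl

theorem quasiOrbit_succ (β : ℝ) (i : ℕ) : quasiOrbit β (i + 1) = quasiT β (quasiOrbit β i) :=
  iterate_succ_apply' _ _ _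

theorem quasiOrbit_mem_Ioc (β : ℝ) (i : ℕ) : quasiOrbit β i ∈ Ioc (0 : ℝ) 1 := by
  cases i with
  | zero => simp [quasiOrbit_zero]
  | succ i => rw [quasiOrbit_succ]; exact quasiT_mem_Ioc _ _

theorem quasiOrbit_add_eq {β : ℝ} {i j : ℕ} (h : quasiOrbit β i = quasiOrbit β j) (k : ℕ) :
    quasiOrbit β (i + k) = quasiOrbit β (j + k) := by
  simp only [quasiOrbit, add_comm _ k, iterate_add_apply] at h ⊢
  rw [h]

theorem quasiOrbit_of_forall_ne {β : ℝ} (h : ∀ i, (T β)^[i] 1 ≠ 0) (i : ℕ) :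
    quasiOrbit β i = (T β)^[i] 1 := by
  induction i with
  | zero => rfl
  | succ i ih =>
    have hi := h (i + 1)
    rw [iterate_succ_apply'] at hi ⊢
    rw [quasiOrbit_succ, ih, quasiT_of_T_ne_zero hi]

theorem pos_of_isLeast_T_iterate {β : ℝ} {N : ℕ} (hN : IsLeast {i | (T β)^[i] 1 = 0} N) : 0 < N :=
  Nat.pos_of_ne_zero fun h => one_ne_zero (α := ℝ) (h ▸ hN.1 : (T β)^[0] (1 : ℝ) = 0)

theorem succ_mod_eq_ite {N : ℕ} (hN : 0 < N) (i : ℕ) :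
    (i + 1) % N = if i % N + 1 = N then 0 else i % N + 1 := by
  have hlt := Nat.mod_lt i hN
  rw [← Nat.mod_add_mod]
  split_ifs with h
  · rw [h, Nat.mod_self]
  · exact Nat.mod_eq_of_lt (by omega)

theorem quasiOrbit_of_isLeast {β : ℝ} {N : ℕ} (hN : IsLeast {i | (T β)^[i] 1 = 0} N) (i : ℕ) :
    quasiOrbit β i = (T β)^[i % N] 1 := by
  have hpos := pos_of_isLeast_T_iterate hN
  induction i with
  | zero => simp [quasiOrbit_zero]
  | succ i ih =>
    have hlt := Nat.mod_lt i hpos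
    rw [quasiOrbit_succ, ih, succ_mod_eq_ite hpos]
    split_ifs with h
    · have hzero : T β ((T β)^[i % N] 1) = 0 := by
        rw [← iterate_succ_apply' (T β), Nat.succ_eq_add_one, h]
        exact hN.1
      rw [quasiT_of_T_eq_zero hzero, iterate_zero_apply]
    · rw [iterate_succ_apply']
      refine quasiT_of_T_ne_zero fun h0 => ?_
      rw [← iterate_succ_apply' (T β)] at h0
      have := hN.2 h0
      omega

theorem exists_isLeast_or_forall_ne (β : ℝ) :
    (∃ N, IsLeast {i | (T β)^[i] 1 = 0} N) ∨ ∀ i, (T β)^[i] 1 ≠ 0 := by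
  classical
  by_cases h : ∃ i, (T β)^[i] 1 = 0
  · exact .inl ⟨Nat.find h, Nat.isLeast_find h⟩
  · exact .inr (not_exists.1 h)

theorem one_mem_Icc_zero_one : (1 : ℝ) ∈ Icc (0 : ℝ) 1 := right_mem_Icc.2 zero_le_one

theorem dstar_of_forall_ne {β : ℝ} (hβ : 1 < β) (h : ∀ i, (T β)^[i] 1 ≠ 0) (i : ℕ) :
    dstar β i = digit β 1 i :=
  dif_neg fun ⟨N, hN⟩ => h N ((T_iterate_eq_zero_iff hβ one_mem_Icc_zero_one N).2 hN)

theorem dstar_of_isLeast {β : ℝ} (hβ : 1 < β) {N : ℕ} (hN : IsLeast {i | (T β)^[i] 1 = 0} N)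
    (i : ℕ) :
    dstar β i = if i % N = N - 1 then digit β 1 (i % N) - 1 else digit β 1 (i % N) := by
  classical
  have hiff := T_iterate_eq_zero_iff hβ one_mem_Icc_zero_one
  have hex : ∃ N, ∀ j, N ≤ j → digit β 1 j = 0 := ⟨N, (hiff N).1 hN.1⟩
  obtain rfl : Nat.find hex = N := (Nat.find_eq_iff hex).2
    ⟨(hiff N).1 hN.1, fun n hn h => hn.not_ge (hN.2 ((hiff n).2 h))⟩
  exact dif_pos hex

theorem mul_quasiOrbit {β : ℝ} (hβ : 1 < β) (i : ℕ) :
    β * quasiOrbit β i = dstar β i + quasiOrbit β (i + 1) := by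
  have hβ0 : 0 < β := by linarith
  have hT := (isRemainderSeq_T_iterate hβ0.le one_mem_Icc_zero_one).mul_eq
  rcases exists_isLeast_or_forall_ne β with ⟨N, hN⟩ | hne
  · have hpos := pos_of_isLeast_T_iterate hN
    have hlt := Nat.mod_lt i hpos
    rw [quasiOrbit_of_isLeast hN, quasiOrbit_of_isLeast hN, dstar_of_isLeast hβ hN,
      succ_mod_eq_ite hpos, hT]
    split_ifs with hlast hend hend
    · have hzero : (T β)^[i % N + 1] 1 = 0 := by rw [hend]; exact hN.1
      have hprev := quasiOrbit_mem_Ioc β i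
      rw [quasiOrbit_of_isLeast hN] at hprev
      have hdigit : (0 : ℝ) < digit β 1 (i % N) := by
        linarith [hT (i % N), mul_pos hβ0 hprev.1]
      have hone : 1 ≤ digit β 1 (i % N) := by exact_mod_cast hdigit
      rw [hzero, iterate_zero_apply]
      push_cast [hone]
      ring
    all_goals first | rfl | omega
  · rw [quasiOrbit_of_forall_ne hne, quasiOrbit_of_forall_ne hne, dstar_of_forall_ne hβ hne, hT]

theorem isRemainderSeq_quasiOrbit {β : ℝ} (hβ : 1 < β) :
    IsRemainderSeq β (dstar β) (quasiOrbit β) :=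
  ⟨fun i => Ioc_subset_Icc_self (quasiOrbit_mem_Ioc β i), mul_quasiOrbit hβ⟩

theorem quasiOrbit_eq_iff {β : ℝ} (hβ : 1 < β) (i j : ℕ) :
    quasiOrbit β i = quasiOrbit β j ↔ ∀ k, dstar β (i + k) = dstar β (j + k) := by
  have hrem := isRemainderSeq_quasiOrbit hβ
  refine ⟨fun h k => ?_, fun h => ?_⟩
  · have hcast : (dstar β (i + k) : ℝ) = dstar β (j + k) := by
      have hi := hrem.mul_eq (i + k)
      rw [quasiOrbit_add_eq h k, add_assoc, quasiOrbit_add_eq h (k + 1), ← add_assoc] at hi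
      linarith [hrem.mul_eq (j + k)]
    exact_mod_cast hcast
  · have hi := hrem.shift i
    simp only [h] at hi
    exact hi.apply_zero_eq hβ (hrem.shift j)

theorem forall_dstar_add_eq_iff {β : ℝ} (hβ : 1 < β) (m p : ℕ) :
    (∀ i, m ≤ i → dstar β (i + p) = dstar β i) ↔ quasiOrbit β (m + p) = quasiOrbit β m := by
  rw [quasiOrbit_eq_iff hβ]
  refine ⟨fun h k => by rw [add_right_comm]; exact h _ (by omega), fun h i hi => ?_⟩
  obtain ⟨k, rfl⟩ := Nat.exists_eq_add_of_le hi
  rw [add_right_comm, h k]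

theorem preperiod_le {β : ℝ} (hβ : 1 < β) {m p : ℕ} (hp : 0 < p)
    (h : quasiOrbit β (m + p) = quasiOrbit β m) : preperiod β ≤ m :=
  Nat.sInf_le ⟨p, hp, (forall_dstar_add_eq_iff hβ _ _).2 h⟩

theorem period_le {β : ℝ} (hβ : 1 < β) {p : ℕ} (hp : 0 < p)
    (h : quasiOrbit β (preperiod β + p) = quasiOrbit β (preperiod β)) : period β ≤ p :=
  Nat.sInf_le ⟨hp, (forall_dstar_add_eq_iff hβ _ _).2 h⟩

theorem quasiOrbit_eq_T_iterate {β : ℝ} (hβ : 1 < β) {i : ℕ} (hi : i < size β) :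
    quasiOrbit β i = (T β)^[i] 1 := by
  rcases exists_isLeast_or_forall_ne β with ⟨N, hN⟩ | hne
  · have hpos := pos_of_isLeast_T_iterate hN
    have hperiod : quasiOrbit β (0 + N) = quasiOrbit β 0 := by simp [quasiOrbit_of_isLeast hN]
    have hm : preperiod β = 0 := Nat.le_zero.1 (preperiod_le hβ hpos hperiod)
    have hn : period β ≤ N := period_le hβ hpos (by rw [hm, hperiod])
    rw [size] at hi
    rw [quasiOrbit_of_isLeast hN, Nat.mod_eq_of_lt (by omega)]
  · exact quasiOrbit_of_forall_ne hne i

theorem quasiOrbit_sub_one_eq {β : ℝ} (hβ : 1 < β) {b : ℕ} (hb : b ∈ Icc 1 (size β)) :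
    quasiOrbit β (b - 1) = (T β)^[b - 1] 1 :=
  quasiOrbit_eq_T_iterate hβ (Nat.sub_one_lt_of_le hb.1 hb.2)

/-! ### Parry numbers -/

/-- A Parry number: a base `β > 1` for which `d*_β(1)` is eventually periodic, expressed by the
finiteness of the quasi-greedy orbit of `1`. -/
structure IsParry (β : ℝ) : Prop where
  one_lt : 1 < β
  finite_range : (range (quasiOrbit β)).Finite

namespace IsParry

variable {β : ℝ} (hβ : IsParry β)

include hβ

theorem exists_quasiOrbit_preperiod_add_eq :
    ∃ p, 0 < p ∧ quasiOrbit β (preperiod β + p) = quasiOrbit β (preperiod β) := by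
  simp only [← forall_dstar_add_eq_iff hβ.one_lt]
  refine Nat.sInf_mem (s := {m | ∃ p, 0 < p ∧ ∀ i, m ≤ i → dstar β (i + p) = dstar β i}) ?_
  obtain ⟨i, j, hij, h⟩ := hβ.finite_range.exists_lt_map_eq_of_forall_mem (mem_range_self (ι := ℕ))
  refine ⟨i, j - i, by omega, (forall_dstar_add_eq_iff hβ.one_lt _ _).2 ?_⟩
  rw [Nat.add_sub_cancel' hij.le, h]

theorem period_mem : 0 < period β ∧ ∀ i, preperiod β ≤ i → dstar β (i + period β) = dstar β i := by
  obtain ⟨p, hp, h⟩ := hβ.exists_quasiOrbit_preperiod_add_eq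
  exact Nat.sInf_mem (s := {p | 0 < p ∧ ∀ i, preperiod β ≤ i → dstar β (i + p) = dstar β i})
    ⟨p, hp, (forall_dstar_add_eq_iff hβ.one_lt _ _).2 h⟩

theorem period_pos : 0 < period β := hβ.period_mem.1

theorem size_pos : 0 < size β := Nat.add_pos_right _ hβ.period_pos

theorem quasiOrbit_size : quasiOrbit β (size β) = quasiOrbit β (preperiod β) :=
  (forall_dstar_add_eq_iff hβ.one_lt _ _).1 hβ.period_mem.2

theorem quasiOrbit_ne_of_lt {i j : ℕ} (hij : i < j) (hj : j < size β) :
    quasiOrbit β i ≠ quasiOrbit β j := fun h => by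
  have hi : preperiod β ≤ i := preperiod_le hβ.one_lt (p := j - i) (by omega)
    (by rw [Nat.add_sub_cancel' hij.le, h])
  -- Following both orbits until `j` reaches the end of the period shows that `n - m - (j - i)` is
  -- also a period.
  have hend := quasiOrbit_add_eq h (size β - j)
  rw [Nat.add_sub_cancel' hj.le, hβ.quasiOrbit_size] at hend
  have hperiod : period β ≤ i + (size β - j) - preperiod β := period_le hβ.one_lt (by omega)
    (by rw [Nat.add_sub_cancel' (by omega), hend])
  have := size.eq_1 β
  omega

theorem quasiOrbit_injOn : InjOn (quasiOrbit β) (Iio (size β)) := fun _ hi _ hj h =>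
  le_antisymm (not_lt.1 fun hlt => hβ.quasiOrbit_ne_of_lt hlt hi h.symm)
    (not_lt.1 fun hlt => hβ.quasiOrbit_ne_of_lt hlt hj h)

theorem exists_isOrbitOrdering : ∃ a : ℕ → ℕ, IsOrbitOrdering β a := by
  have hinj : InjOn (fun b => (T β)^[b - 1] 1) (Finset.Icc 1 (size β)) := fun i hi j hj h => by
    rw [Finset.coe_Icc] at hi hj
    simp only [← quasiOrbit_sub_one_eq hβ.one_lt hi, ← quasiOrbit_sub_one_eq hβ.one_lt hj] at h
    have hsub := hβ.quasiOrbit_injOn (mem_Iio.2 (Nat.sub_one_lt_of_le hi.1 hi.2))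
      (mem_Iio.2 (Nat.sub_one_lt_of_le hj.1 hj.2)) h
    have := hi.1
    have := hj.1
    omega
  obtain ⟨a, hbij, hmono⟩ := exists_bijOn_strictMonoOn_comp hinj
  rw [Finset.coe_Icc] at hbij hmono
  exact ⟨a, hbij, hmono⟩

end IsParry

/-! ### The admissibility graph -/

section Graph

variable {β : ℝ}

theorem LexLT.of_le {u v w : ℕ → ℕ} (h : ∀ i, u i ≤ v i) (h' : LexLT v w) : LexLT u w :=
  (Pi.toLex_monotone h).trans_lt (show toLex v < toLex w from h')

theorem Admissible.of_append {w w' : List ℕ} (h : Admissible β (w ++ w')) : Admissible β w := by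
  refine ⟨fun d hd => h.1 d (List.mem_append_left _ hd), fun k => (h.2 k).of_le fun i => ?_⟩
  rcases lt_or_ge (k + i) w.length with hlt | hge
  · rw [List.getD_append _ _ _ _ hlt]
  · rw [List.getD_eq_default _ _ hge]
    exact Nat.zero_le _

theorem leads_nil_iff {b a : ℕ} : Leads β b [] a ↔ b = a :=
  ⟨fun | .nil _ => rfl, fun h => h ▸ .nil b⟩

theorem leads_cons_iff {b a ε : ℕ} {w : List ℕ} :
    Leads β b (ε :: w) a ↔ ∃ c, Edge β b ε c ∧ Leads β c w a :=
  ⟨fun | .cons h h' => ⟨_, h, h'⟩, fun ⟨_, h, h'⟩ => .cons h h'⟩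

theorem leads_append_iff {b a : ℕ} {w w' : List ℕ} :
    Leads β b (w ++ w') a ↔ ∃ c, Leads β b w c ∧ Leads β c w' a := by
  induction w generalizing b with
  | nil => simp only [List.nil_append, leads_nil_iff, exists_eq_left']
  | cons ε w ih => simp only [List.cons_append, leads_cons_iff, ih]; tauto

theorem leads_append_singleton_iff {b a ε : ℕ} {w : List ℕ} :
    Leads β b (w ++ [ε]) a ↔ ∃ c, Leads β b w c ∧ Edge β c ε a := by
  simp only [leads_append_iff, leads_cons_iff, leads_nil_iff, exists_eq_right]

theorem digit_le_dstar_of_edge {b ε a : ℕ} (h : Edge β b ε a) : ε ≤ dstar β (b - 1) := by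
  obtain ⟨-, ⟨hε, -⟩ | ⟨hε, -⟩ | ⟨hε, -⟩⟩ := h
  exacts [hε.le, hε.le, hε.le]

theorem finite_setOf_edge (β : ℝ) (a : ℕ) : {i : ℕ × ℕ | Edge β i.1 i.2 a}.Finite := by
  refine ((finite_Icc 1 (size β)).biUnion fun b _ =>
    (finite_Iic (dstar β (b - 1))).image (Prod.mk b)).subset fun ⟨b, ε⟩ h => ?_
  exact mem_biUnion h.1 ⟨ε, digit_le_dstar_of_edge h, rfl⟩

/-- The string of the first `k` digits of the beta-expansion of `x`. -/
noncomputable def digits (β x : ℝ) (k : ℕ) : List ℕ := (List.range k).map (digit β x)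

theorem digits_succ (β x : ℝ) (k : ℕ) : digits β x (k + 1) = digits β x k ++ [digit β x k] := by
  simp [digits, List.range_succ]

theorem getD_digits_le (β x : ℝ) (k i : ℕ) : (digits β x k).getD i 0 ≤ digit β x i := by
  rcases lt_or_ge i k with h | h
  · rw [List.getD_eq_getElem _ _ (by simpa [digits] using h)]
    simp [digits]
  · rw [List.getD_eq_default _ _ (by simpa [digits] using h)]
    exact Nat.zero_le _

theorem digit_lt_ceil {x : ℝ} (hβ : 0 < β) (hx : x ∈ Ico (0 : ℝ) 1) (i : ℕ) :
    digit β x i < ⌈β⌉₊ := by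
  have hdigit := (isRemainderSeq_T_iterate hβ.le (Ico_subset_Icc_self hx)).digit_le_mul i
  have hmul : β * (T β)^[i] x < β := mul_lt_of_lt_one_right hβ (T_iterate_mem_Ico β hx i).2
  exact Nat.lt_ceil.2 (hdigit.trans_lt hmul)

theorem dstar_zero_pos (hβ : 1 < β) : 0 < dstar β 0 := by
  have hmul := mul_quasiOrbit hβ 0
  rw [quasiOrbit_zero, mul_one] at hmul
  have hpos : (0 : ℝ) < dstar β 0 := by linarith [(quasiOrbit_mem_Ioc β 1).2]
  exact_mod_cast hpos

theorem dstar_le_ceil (hβ : 1 < β) (i : ℕ) : dstar β i ≤ ⌈β⌉₊ := by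
  have hmul : β * quasiOrbit β i ≤ β :=
    mul_le_of_le_one_right (by linarith) (quasiOrbit_mem_Ioc β i).2
  exact_mod_cast ((isRemainderSeq_quasiOrbit hβ).digit_le_mul i).trans
    (hmul.trans (Nat.le_ceil β))

theorem lexLT_digit_dstar {x : ℝ} (hβ : 1 < β) (hx : x ∈ Ico (0 : ℝ) 1) :
    LexLT (digit β x) (dstar β) :=
  (isRemainderSeq_T_iterate (by linarith) (Ico_subset_Icc_self hx)).lexLT hβ
    (isRemainderSeq_quasiOrbit hβ) hx.2

theorem admissible_digits {x : ℝ} (hβ : 1 < β) (hx : x ∈ Ico (0 : ℝ) 1) (k : ℕ) :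
    Admissible β (digits β x k) := by
  refine ⟨fun d hd => ?_, fun j => ?_⟩
  · obtain ⟨i, -, rfl⟩ := List.mem_map.1 hd
    exact digit_lt_ceil (by linarith) hx i
  · refine (lexLT_digit_dstar hβ (T_iterate_mem_Ico β hx j)).of_le fun i => ?_
    rw [digit_T_iterate]
    exact getD_digits_le β x k (j + i)

theorem nil_mem_language (hβ : 1 < β) : [] ∈ language β 1 :=
  ⟨⟨by simp, fun k => ⟨0, by simp, by simpa using dstar_zero_pos hβ⟩⟩, .nil 1⟩

end Graph

namespace IsParry

variable {β : ℝ} (hβ : IsParry β)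

include hβ

theorem mem_Icc_of_edge {b ε a : ℕ} (h : Edge β b ε a) : a ∈ Icc 1 (size β) := by
  have hperiod := hβ.period_pos
  have hsize := size.eq_1 β
  obtain ⟨-, ⟨-, rfl⟩ | ⟨-, hb, rfl⟩ | ⟨-, -, rfl⟩⟩ := h <;> constructor <;> omega

theorem edge_cases {b ε a : ℕ} (h : Edge β b ε a) :
    (ε < dstar β (b - 1) ∧ a = 1) ∨
      (ε = dstar β (b - 1) ∧ quasiOrbit β (a - 1) = quasiOrbit β b) := by
  obtain ⟨-, h | ⟨hε, -, rfl⟩ | ⟨hε, rfl, rfl⟩⟩ := h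
  · exact .inl h
  · exact .inr ⟨hε, rfl⟩
  · exact .inr ⟨hε, hβ.quasiOrbit_size.symm⟩

theorem exists_edge_of_le {b ε : ℕ} {x : ℝ} (hb : b ∈ Icc 1 (size β)) (hx : x < 1)
    (hε : ε ≤ dstar β (b - 1)) (hlt : ε = dstar β (b - 1) → x < quasiOrbit β b) :
    ∃ a, Edge β b ε a ∧ x < quasiOrbit β (a - 1) := by
  rcases hε.lt_or_eq with hε | hε
  · exact ⟨1, ⟨hb, .inl ⟨hε, rfl⟩⟩, hx⟩
  · have hx := hlt hε
    rcases hb.2.lt_or_eq with hb' | hb'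
    · exact ⟨b + 1, ⟨hb, .inr (.inl ⟨hε, hb', rfl⟩)⟩, hx⟩
    · refine ⟨preperiod β + 1, ⟨hb, .inr (.inr ⟨hε, hb', rfl⟩)⟩, ?_⟩
      rwa [hb', hβ.quasiOrbit_size] at hx

theorem div_lt_of_edge {b ε a : ℕ} (h : Edge β b ε a) {x : ℝ} (hx : x < 1)
    (hxa : x < quasiOrbit β (a - 1)) : (x + ε) / β < quasiOrbit β (b - 1) := by
  have hβ0 : 0 < β := zero_lt_one.trans hβ.one_lt
  rw [div_lt_iff₀' hβ0, mul_quasiOrbit hβ.one_lt, Nat.sub_add_cancel h.1.1]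
  rcases hβ.edge_cases h with ⟨hε, -⟩ | ⟨hε, ha⟩
  · have hε' : (ε : ℝ) + 1 ≤ dstar β (b - 1) := by exact_mod_cast hε
    linarith [(quasiOrbit_mem_Ioc β b).1]
  · rw [hε]
    linarith

theorem exists_leads_digits {x : ℝ} (hx : x ∈ Ico (0 : ℝ) 1) (k : ℕ) :
    ∃ a ∈ Icc 1 (size β), Leads β 1 (digits β x k) a ∧ (T β)^[k] x < quasiOrbit β (a - 1) := by
  have hβ0 : 0 < β := zero_lt_one.trans hβ.one_lt
  have hrem := isRemainderSeq_T_iterate hβ0.le (Ico_subset_Icc_self hx)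
  have hquasi := isRemainderSeq_quasiOrbit hβ.one_lt
  induction k with
  | zero => exact ⟨1, ⟨le_rfl, hβ.size_pos⟩, .nil 1, hx.2⟩
  | succ k ih =>
    obtain ⟨b, hb, hleads, hlt⟩ := ih
    obtain ⟨a, hedge, hlt'⟩ := hβ.exists_edge_of_le hb (T_iterate_mem_Ico β hx (k + 1)).2
      (hrem.digit_le_of_lt hβ0 hquasi hlt) fun hd => by
        simpa only [Nat.sub_add_cancel hb.1] using hrem.succ_lt_succ hβ0 hquasi hlt hd
    rw [digits_succ]
    exact ⟨a, hβ.mem_Icc_of_edge hedge, leads_append_singleton_iff.2 ⟨b, hleads, hedge⟩, hlt'⟩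

end IsParry

/-! ### Number fields -/

section NumberField

variable (K : Type*) [Field K] [NumberField K]

theorem finite_setOf_isIntegral_norm_le (C : (K →+* ℂ) → ℝ) :
    {x : K | IsIntegral ℤ x ∧ ∀ τ : K →+* ℂ, ‖τ x‖ ≤ C τ}.Finite :=
  (NumberField.Embeddings.finite_of_norm_le K ℂ (∑ τ, |C τ|)).subset fun _ ⟨hint, hle⟩ =>
    ⟨hint, fun τ => (hle τ).trans <| (le_abs_self _).trans <|
      Finset.single_le_sum (f := fun τ => |C τ|) (fun _ _ => abs_nonneg _) (Finset.mem_univ τ)⟩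

variable {K}

theorem isIntegral_iff_forall_valuation_le_one {x : K} :
    IsIntegral ℤ x ↔ ∀ P : HeightOneSpectrum (𝓞 K), P.valuation K x ≤ 1 := by
  refine ⟨fun h P => P.valuation_le_one (⟨x, h⟩ : 𝓞 K), fun h => ?_⟩
  obtain ⟨y, rfl⟩ := HeightOneSpectrum.mem_integers_of_valuation_le_one K x h
  exact y.2

theorem finite_setOf_valuation_mul_le_one_norm_le {q : K} (hq : q ≠ 0) (C : (K →+* ℂ) → ℝ) :
    {x : K | (∀ P : HeightOneSpectrum (𝓞 K), P.valuation K (q * x) ≤ 1) ∧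
      ∀ τ : K →+* ℂ, ‖τ x‖ ≤ C τ}.Finite := by
  refine ((finite_setOf_isIntegral_norm_le K fun τ => ‖τ q‖ * C τ).preimage
    (mul_right_injective₀ hq).injOn).subset fun x ⟨hval, hle⟩ => ?_
  refine ⟨isIntegral_iff_forall_valuation_le_one.2 hval, fun τ => ?_⟩
  rw [map_mul, norm_mul]
  gcongr
  exact hle τ

end NumberField

/-! ### Embeddings of `ℚ(β)` -/

section BetaField

variable {β : ℝ}

theorem coe_gen (β : ℝ) : ((gen β : BetaField β) : ℝ) = β :=
  IntermediateField.AdjoinSimple.coe_gen ℚ β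

theorem ringHom_ext_gen {L : Type*} [Field L] [CharZero L] {τ σ : BetaField β →+* L}
    (h : τ (gen β) = σ (gen β)) : τ = σ := by
  have halg : τ.toRatAlgHom = σ.toRatAlgHom :=
    IntermediateField.adjoin_algHom_ext ℚ fun x hx => by
      obtain rfl : x = β := hx
      exact h
  exact RingHom.ext fun x => DFunLike.congr_fun halg x

theorem apply_eq_of_apply_gen {τ : BetaField β →+* ℂ} (h : τ (gen β) = β) (x : BetaField β) :
    τ x = (x : ℝ) := by
  have hτ : τ = Complex.ofRealHom.comp (algebraMap (BetaField β) ℝ) :=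
    ringHom_ext_gen (by rw [h]; exact congrArg Complex.ofReal (coe_gen β).symm)
  rw [hτ]
  rfl

theorem realConj_gen_ne (σ : RealConj β) : σ.1 (gen β) ≠ β := fun h =>
  σ.2 (ringHom_ext_gen (h.trans (coe_gen β).symm))

theorem complexConj_gen_ne (σ : ComplexConj β) : σ.1 (gen β) ≠ (β : ℂ) := fun h => by
  have him := σ.2
  rw [h, Complex.ofReal_im] at him
  exact lt_irrefl 0 him

theorem exists_conj_norm_eq {τ : BetaField β →+* ℂ} (hτ : τ (gen β) ≠ β) :
    (∃ σ : RealConj β, ∀ z, ‖τ z‖ = ‖σ.1 z‖) ∨ ∃ σ : ComplexConj β, ∀ z, ‖τ z‖ = ‖σ.1 z‖ := by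
  rcases lt_trichotomy 0 (τ (gen β)).im with him | him | him
  · exact .inr ⟨⟨τ, him⟩, fun _ => rfl⟩
  · have hreal : NumberField.ComplexEmbedding.IsReal τ :=
      NumberField.ComplexEmbedding.isReal_iff.2
        (ringHom_ext_gen (Complex.conj_eq_iff_im.2 him.symm))
    have hcoe := hreal.coe_embedding_apply
    refine .inl ⟨⟨hreal.embedding, fun h => hτ ?_⟩, fun z => ?_⟩
    · rw [← hcoe, h]
      exact congrArg Complex.ofReal (coe_gen β)
    · rw [← hcoe, Complex.norm_real]
  · refine .inr ⟨⟨NumberField.ComplexEmbedding.conjugate τ, ?_⟩, fun z => ?_⟩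
    · simpa using him
    · simp

/-- A bound for the images under the embedding `τ` of the integers in base `β`, obtained from the
geometric series; it is meaningful only if `τ β` has norm less than `1`. -/
noncomputable def conjBound {L : Type*} [NormedField L] (τ : BetaField β →+* L) : ℝ :=
  ⌈β⌉₊ / (1 - ‖τ (gen β)‖)

section conjBound

variable {L : Type*} [NormedField L] {τ : BetaField β →+* L}

theorem natCeil_le_conjBound (h : ‖τ (gen β)‖ < 1) : ⌈β⌉₊ ≤ conjBound τ :=
  le_div_self (Nat.cast_nonneg _) (by linarith) (by linarith [norm_nonneg (τ (gen β))])

theorem norm_mul_add_le_conjBound (h : ‖τ (gen β)‖ < 1) {y d : L} (hy : ‖y‖ ≤ conjBound τ)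
    (hd : ‖d‖ ≤ ⌈β⌉₊) : ‖τ (gen β) * y + d‖ ≤ conjBound τ := by
  have hne : 1 - ‖τ (gen β)‖ ≠ 0 := by linarith
  calc ‖τ (gen β) * y + d‖ ≤ ‖τ (gen β)‖ * ‖y‖ + ‖d‖ := by
        rw [← norm_mul]
        exact norm_add_le _ _
    _ ≤ ‖τ (gen β)‖ * conjBound τ + ⌈β⌉₊ := by gcongr
    _ = conjBound τ := by
        rw [conjBound]
        field_simp
        ring

end conjBound

/-! ### Values of strings -/

theorem value_nil (β : ℝ) : value β [] = 0 := rfl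

theorem value_append_singleton (w : List ℕ) (ε : ℕ) :
    value β (w ++ [ε]) = gen β * value β w + ε := by
  simp [value, Nat.ofDigits, add_comm]

theorem IsParry.exists_edge_of_mem_language (hβ : IsParry β) {a : ℕ} {w : List ℕ}
    (h : w ∈ language β a) :
    ∃ b ε, Edge β b ε a ∧ ∃ v ∈ language β b, value β w = gen β * value β v + ε := by
  rcases List.eq_nil_or_concat' w with rfl | ⟨v, ε, rfl⟩
  · obtain rfl : 1 = a := leads_nil_iff.1 h.2
    exact ⟨1, 0, ⟨⟨le_rfl, hβ.size_pos⟩, .inl ⟨dstar_zero_pos hβ.one_lt, rfl⟩⟩,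
      [], nil_mem_language hβ.one_lt, by simp [value_nil]⟩
  · obtain ⟨b, hleads, hedge⟩ := leads_append_singleton_iff.1 h.2
    exact ⟨b, ε, hedge, v, ⟨h.1.of_append, hleads⟩, value_append_singleton v ε⟩

theorem norm_value_le {L : Type*} [NormedField L] {τ : BetaField β →+* L} (h : ‖τ (gen β)‖ < 1)
    {w : List ℕ} (hw : ∀ d ∈ w, d < ⌈β⌉₊) : ‖τ (value β w)‖ ≤ conjBound τ := by
  induction w using List.reverseRecOn with
  | nil =>
    rw [value_nil, map_zero, norm_zero]
    exact (Nat.cast_nonneg _).trans (natCeil_le_conjBound h)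
  | append_singleton w ε ih =>
    have hε : (ε : ℝ) ≤ ⌈β⌉₊ := by exact_mod_cast (hw ε (by simp)).le
    rw [value_append_singleton, map_add, map_mul, map_natCast]
    refine norm_mul_add_le_conjBound h (ih fun d hd => hw d (List.mem_append_left _ hd)) ?_
    exact (Nat.norm_cast_le ε).trans (by simpa using hε)

theorem coe_value_digits {x : ℝ} (hβ : 0 ≤ β) (hx : x ∈ Icc (0 : ℝ) 1) (k : ℕ) :
    (value β (digits β x k) : ℝ) = β ^ k * x - (T β)^[k] x := by
  induction k with
  | zero => simp [digits, value_nil]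
  | succ k ih =>
    have hmul := (isRemainderSeq_T_iterate hβ hx).mul_eq k
    rw [digits_succ, value_append_singleton]
    push_cast
    rw [ih, coe_gen, pow_succ]
    linarith

end BetaField

section Pisot

variable {β : ℝ} [hβ : Fact (IsPisot β)]

theorem isIntegral_value (w : List ℕ) : IsIntegral ℤ (value β w) := by
  induction w using List.reverseRecOn with
  | nil => exact isIntegral_zero
  | append_singleton w ε ih =>
    rw [value_append_singleton]
    exact ((isIntegral_gen β).mul ih).add (isIntegral_natCast _)

theorem norm_gen_lt_one {τ : BetaField β →+* ℂ} (h : τ (gen β) ≠ β) : ‖τ (gen β)‖ < 1 := by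
  refine hβ.out.norm_conj_lt_one _ ?_ h
  rw [← IntermediateField.minpoly_gen ℚ β]
  exact minpoly.aeval_algHom ℚ τ.toRatAlgHom (gen β)

theorem norm_realConj_gen_lt_one (σ : RealConj β) : ‖σ.1 (gen β)‖ < 1 := by
  rw [← Complex.norm_real]
  exact norm_gen_lt_one (τ := Complex.ofRealHom.comp σ.1)
    fun h => realConj_gen_ne σ (Complex.ofReal_injective h)

theorem norm_complexConj_gen_lt_one (σ : ComplexConj β) : ‖σ.1 (gen β)‖ < 1 :=
  norm_gen_lt_one (complexConj_gen_ne σ)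

theorem exists_isIntegral_coe_eq_quasiOrbit (i : ℕ) :
    ∃ z : BetaField β, IsIntegral ℤ z ∧ (z : ℝ) = quasiOrbit β i ∧
      ∀ τ : BetaField β →+* ℂ, τ (gen β) ≠ β → ‖τ z‖ ≤ conjBound τ := by
  have hβ1 := hβ.out.one_lt
  induction i with
  | zero =>
    refine ⟨1, isIntegral_one, rfl, fun τ hτ => ?_⟩
    rw [map_one, norm_one]
    exact hβ1.le.trans ((Nat.le_ceil β).trans (natCeil_le_conjBound (norm_gen_lt_one hτ)))
  | succ i ih =>
    obtain ⟨z, hint, hcoe, hle⟩ := ih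
    refine ⟨gen β * z - dstar β i, ((isIntegral_gen β).mul hint).sub (isIntegral_natCast _), ?_,
      fun τ hτ => ?_⟩
    · push_cast
      rw [coe_gen, hcoe]
      linarith [mul_quasiOrbit hβ1 i]
    · rw [map_sub, map_mul, map_natCast, sub_eq_add_neg]
      refine norm_mul_add_le_conjBound (norm_gen_lt_one hτ) (hle τ hτ) ?_
      simpa using dstar_le_ceil hβ1 i

theorem isParry_of_isPisot (β : ℝ) [hβ : Fact (IsPisot β)] : IsParry β := by
  refine ⟨hβ.out.one_lt, ((finite_setOf_isIntegral_norm_le (BetaField β)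
    fun τ => max 1 (conjBound τ)).image Subtype.val).subset ?_⟩
  rintro _ ⟨i, rfl⟩
  obtain ⟨z, hint, hcoe, hle⟩ := exists_isIntegral_coe_eq_quasiOrbit (β := β) i
  refine ⟨z, ⟨hint, fun τ => ?_⟩, hcoe⟩
  by_cases hτ : τ (gen β) = β
  · have hmem := quasiOrbit_mem_Ioc β i
    rw [apply_eq_of_apply_gen hτ, hcoe, Complex.norm_real, Real.norm_of_nonneg hmem.1.le]
    exact le_max_of_le_left hmem.2
  · exact le_max_of_le_right (hle τ hτ)

/-! ### Tiles -/

theorem gen_ne_zero : gen β ≠ 0 := fun h => by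
  have hcoe := coe_gen β
  rw [h] at hcoe
  exact (zero_lt_one.trans hβ.out.one_lt).ne hcoe

variable (β) in
/-- `φ_β` as a ring homomorphism. -/
noncomputable def phiHom : BetaField β →+* KBeta β :=
  ((RingHom.pi fun σ : RealConj β => σ.1).prod (RingHom.pi fun σ : ComplexConj β => σ.1)).prod
    (RingHom.pi fun P : PrimesAbove β =>
      algebraMap (BetaField β) (P.1.adicCompletion (BetaField β)))

theorem phi_eq_phiHom : phi β = phiHom β := rfl

theorem valued_phiFin (x : BetaField β) (P : PrimesAbove β) :
    Valued.v (phiFin β x P) = P.1.valuation (BetaField β) x :=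
  P.1.valuedAdicCompletion_eq_valuation' x

theorem tendsto_phi_gen_pow : Tendsto (fun k : ℕ => phi β (gen β ^ k)) atTop (𝓝 0) := by
  refine .prodMk_nhds (.prodMk_nhds ?_ ?_) ?_ <;>
    refine tendsto_pi_nhds.2 fun σ => ?_ <;> simp only [phiFin, map_pow]
  · exact tendsto_pow_atTop_nhds_zero_of_norm_lt_one (norm_realConj_gen_lt_one σ)
  · exact tendsto_pow_atTop_nhds_zero_of_norm_lt_one (norm_complexConj_gen_lt_one σ)
  · exact Valued.tendsto_zero_pow_of_v_lt_one <| (valued_phiFin (gen β) σ).trans_lt <|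
      (σ.1.valuation_lt_one_iff_mem (K := BetaField β) (genInt β)).2 σ.2

theorem tile_subset {C : Set (KBeta β)} (hC : IsClosed C)
    (h : ∀ w, Admissible β w → phi β (value β w) ∈ C) : tile β ⊆ C :=
  closure_minimal (image_subset_iff.2 (image_subset_iff.2 h)) hC

theorem norm_realConj_le_of_mem_tile {y : KBeta β} (hy : y ∈ tile β) (σ : RealConj β) :
    ‖y.1.1 σ‖ ≤ conjBound σ.1 :=
  tile_subset (C := {y | ‖y.1.1 σ‖ ≤ conjBound σ.1}) (isClosed_le (by fun_prop) continuous_const)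
    (fun _ hw => norm_value_le (norm_realConj_gen_lt_one σ) hw.1) hy

theorem norm_complexConj_le_of_mem_tile {y : KBeta β} (hy : y ∈ tile β) (σ : ComplexConj β) :
    ‖y.1.2 σ‖ ≤ conjBound σ.1 :=
  tile_subset (C := {y | ‖y.1.2 σ‖ ≤ conjBound σ.1}) (isClosed_le (by fun_prop) continuous_const)
    (fun _ hw => norm_value_le (norm_complexConj_gen_lt_one σ) hw.1) hy

theorem valued_le_one_of_mem_tile {y : KBeta β} (hy : y ∈ tile β) (P : PrimesAbove β) :
    Valued.v (y.2 P) ≤ 1 := by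
  have hclosed : IsClosed {y : KBeta β | Valued.v (y.2 P) ≤ 1} :=
    (Valued.isClosed_integer (P.1.adicCompletion (BetaField β))).preimage (by fun_prop)
  exact tile_subset hclosed (fun w _ => (valued_phiFin _ P).trans_le
    (isIntegral_iff_forall_valuation_le_one.1 (isIntegral_value w) P.1)) hy

theorem norm_le_conjBound_of_neg_phi_mem_tile {z : BetaField β} (hz : -phi β z ∈ tile β)
    {τ : BetaField β →+* ℂ} (hτ : τ (gen β) ≠ β) : ‖τ z‖ ≤ conjBound τ := by
  rcases exists_conj_norm_eq hτ with ⟨σ, hσ⟩ | ⟨σ, hσ⟩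
  · have hle := norm_realConj_le_of_mem_tile hz σ
    rw [Prod.fst_neg, Prod.fst_neg, Pi.neg_apply, norm_neg] at hle
    rw [conjBound, hσ, hσ]
    exact hle
  · have hle := norm_complexConj_le_of_mem_tile hz σ
    rw [Prod.fst_neg, Prod.snd_neg, Pi.neg_apply, norm_neg] at hle
    rw [conjBound, hσ, hσ]
    exact hle

theorem valuation_le_one_of_neg_phi_mem_tile {z : BetaField β} (hz : -phi β z ∈ tile β)
    (P : PrimesAbove β) : P.1.valuation (BetaField β) z ≤ 1 := by
  have hle := valued_le_one_of_mem_tile hz P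
  rw [Prod.snd_neg, Pi.neg_apply, Valuation.map_neg] at hle
  exact (valued_phiFin z P).symm.trans_le hle

theorem subtile_subset_tile (a : ℕ) : subtile β a ⊆ tile β :=
  closure_mono (image_mono (image_mono fun _ h => h.1))

theorem phi_value_mem_subtile {a : ℕ} {w : List ℕ} (h : w ∈ language β a) :
    phi β (value β w) ∈ subtile β a :=
  subset_closure (mem_image_of_mem _ (mem_image_of_mem _ h))

theorem exists_edge_of_mem_subtile {a : ℕ} {y : KBeta β} (hy : y ∈ subtile β a) :
    ∃ b ε, Edge β b ε a ∧ phi β (gen β)⁻¹ * (y - phi β ε) ∈ subtile β b := by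
  suffices hsub : subtile β a ⊆ ⋃ i ∈ {i : ℕ × ℕ | Edge β i.1 i.2 a},
      {y | phi β (gen β)⁻¹ * (y - phi β i.2) ∈ subtile β i.1} by
    obtain ⟨⟨b, ε⟩, hedge, hmem⟩ := mem_iUnion₂.1 (hsub hy)
    exact ⟨b, ε, hedge, hmem⟩
  refine closure_minimal ?_ ((finite_setOf_edge β a).isClosed_biUnion fun i _ =>
    (isClosed_closure (s := phi β '' (value β '' language β i.1))).preimage
      (continuous_const.mul (continuous_id.sub continuous_const)))
  rintro _ ⟨_, ⟨w, hw, rfl⟩, rfl⟩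
  obtain ⟨b, ε, hedge, v, hv, hvalue⟩ := (isParry_of_isPisot β).exists_edge_of_mem_language hw
  refine mem_biUnion (x := (b, ε)) hedge ?_
  have hphi : phi β (gen β)⁻¹ * (phi β (value β w) - phi β ε) = phi β (value β v) := by
    simp only [phi_eq_phiHom, ← map_sub, ← map_mul]
    rw [hvalue, add_sub_cancel_right, inv_mul_cancel_left₀ gen_ne_zero]
  rw [mem_ofPred_eq, hphi]
  exact phi_value_mem_subtile hv

/-! ### Pure periodicity and the natural extension -/

variable (β) in
/-- The domain of the natural extension of the beta-transformation, with the sign chosen such that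
`ℚ(β)` embeds in it by `z ↦ (z, φ_β(z))`. -/
def naturalExtension : Set (ℝ × KBeta β) :=
  ⋃ a ∈ Icc 1 (size β), Ico 0 ((T β)^[a - 1] 1) ×ˢ (-subtile β a)

theorem mem_naturalExtension_iff {x : ℝ} {y : KBeta β} :
    (x, y) ∈ naturalExtension β ↔
      0 ≤ x ∧ ∃ a ∈ Icc 1 (size β), x < (T β)^[a - 1] 1 ∧ -y ∈ subtile β a := by
  simp only [naturalExtension, mem_iUnion₂, mem_prod, mem_Ico, Set.mem_neg, exists_prop]
  tauto

theorem exists_backward_step {z : BetaField β} (hz : ((z : ℝ), phi β z) ∈ naturalExtension β) :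
    ∃ (ε : ℕ) (z' : BetaField β), z' = (z + ε) / gen β ∧
      ((z' : ℝ), phi β z') ∈ naturalExtension β ∧ T β z' = z := by
  have hparry := isParry_of_isPisot β
  have hβ0 : 0 < β := zero_lt_one.trans hβ.out.one_lt
  obtain ⟨hz0, a, ha, hza, hmem⟩ := mem_naturalExtension_iff.1 hz
  rw [← quasiOrbit_sub_one_eq hβ.out.one_lt ha] at hza
  have hz1 : (z : ℝ) < 1 := hza.trans_le (quasiOrbit_mem_Ioc β _).2
  obtain ⟨b, ε, hedge, hmem'⟩ := exists_edge_of_mem_subtile hmem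
  have hcoe : (((z + ε) / gen β : BetaField β) : ℝ) = (z + ε) / β := by
    push_cast
    rw [coe_gen]
  refine ⟨ε, _, rfl, mem_naturalExtension_iff.2 ⟨?_, b, hedge.1, ?_, ?_⟩, ?_⟩
  · rw [hcoe]
    positivity
  · rw [hcoe, ← quasiOrbit_sub_one_eq hβ.out.one_lt hedge.1]
    exact hparry.div_lt_of_edge hedge hz1 hza
  · convert hmem' using 1
    simp only [phi_eq_phiHom, ← map_sub, ← map_mul, ← map_neg]
    congr 1
    field_simp [gen_ne_zero (β := β)]
    ring
  · rw [hcoe, T, mul_div_cancel₀ _ hβ0.ne', Int.fract_add_natCast, Int.fract_eq_self.2 ⟨hz0, hz1⟩]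

theorem valuation_gen_eq_one {P : HeightOneSpectrum (𝓞 (BetaField β))}
    (hP : genInt β ∉ P.asIdeal) : P.valuation (BetaField β) (gen β) = 1 :=
  P.valuation_eq_one_iff_notMem.2 hP

variable (β) in
/-- The `z ∈ ℚ(β)` in the natural extension domain for which `q z` is integral away from `β`: a set
which is finite and stable under backward steps. -/
def extensionPoints (q : BetaField β) : Set (BetaField β) :=
  {z | ((z : ℝ), phi β z) ∈ naturalExtension β ∧
    ∀ P : HeightOneSpectrum (𝓞 (BetaField β)), genInt β ∉ P.asIdeal →
      P.valuation (BetaField β) (q * z) ≤ 1}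

theorem finite_extensionPoints {q : BetaField β} (hq : q ≠ 0) (hint : IsIntegral ℤ q) :
    (extensionPoints β q).Finite := by
  refine (finite_setOf_valuation_mul_le_one_norm_le hq fun τ => max 1 (conjBound τ)).subset ?_
  rintro z ⟨hz, hval⟩
  obtain ⟨hz0, a, -, hza, hmem⟩ := mem_naturalExtension_iff.1 hz
  have htile := subtile_subset_tile a hmem
  refine ⟨fun P => ?_, fun τ => ?_⟩
  · by_cases hP : genInt β ∈ P.asIdeal
    · rw [map_mul]
      exact mul_le_one' (isIntegral_iff_forall_valuation_le_one.1 hint P)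
        (valuation_le_one_of_neg_phi_mem_tile htile ⟨P, hP⟩)
    · exact hval P hP
  · by_cases hτ : τ (gen β) = β
    · rw [apply_eq_of_apply_gen hτ, Complex.norm_real, Real.norm_of_nonneg hz0]
      exact le_max_of_le_left (hza.le.trans (T_iterate_mem_Icc β one_mem_Icc_zero_one _).2)
    · exact le_max_of_le_right (norm_le_conjBound_of_neg_phi_mem_tile htile hτ)

theorem surjOn_T_extensionPoints {q : BetaField β} (hint : IsIntegral ℤ q) :
    SurjOn (T β) ((↑) '' extensionPoints β q) ((↑) '' extensionPoints β q) := by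
  rintro _ ⟨z, ⟨hz, hval⟩, rfl⟩
  obtain ⟨ε, z', rfl, hz', hT⟩ := exists_backward_step hz
  have hval' : ∀ P : HeightOneSpectrum (𝓞 (BetaField β)), genInt β ∉ P.asIdeal →
      P.valuation (BetaField β) (q * ((z + ε) / gen β)) ≤ 1 := fun P hP => by
    rw [mul_div_assoc', map_div₀, valuation_gen_eq_one hP, div_one, mul_add]
    exact Valuation.map_add_le _ (hval P hP)
      (isIntegral_iff_forall_valuation_le_one.1 (hint.mul (isIntegral_natCast _)) P)
  exact ⟨_, mem_image_of_mem _ ⟨hz', hval'⟩, hT⟩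

theorem mem_periodicPts_of_mem_naturalExtension {z : BetaField β}
    (hz : ((z : ℝ), phi β z) ∈ naturalExtension β) : (z : ℝ) ∈ periodicPts (T β) := by
  obtain ⟨q, hq, hqz⟩ := IsAlgebraic.exists_integral_multiple (R := ℤ)
    ((IsFractionRing.isAlgebraic_iff ℤ ℚ (BetaField β)).2 (Algebra.IsAlgebraic.isAlgebraic z))
  rw [zsmul_eq_mul] at hqz
  have hint : IsIntegral ℤ (q : BetaField β) := isIntegral_algebraMap (R := ℤ) (x := q)
  have hmem : z ∈ extensionPoints β q :=
    ⟨hz, fun P _ => isIntegral_iff_forall_valuation_le_one.1 hqz P⟩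
  exact mem_periodicPts_of_surjOn
    ((finite_extensionPoints (Int.cast_ne_zero.2 hq) hint).image (↑))
    (surjOn_T_extensionPoints hint) (mem_image_of_mem _ hmem)

theorem exists_sub_mem_subtile_of_isPeriodicPt {z : BetaField β} (hz : (z : ℝ) ∈ Ico (0 : ℝ) 1)
    {l : ℕ} (h : IsPeriodicPt (T β) l z) :
    ∃ a ∈ Icc 1 (size β), (z : ℝ) < (T β)^[a - 1] 1 ∧
      phi β (gen β ^ l) * phi β z - phi β z ∈ subtile β a := by
  have hparry := isParry_of_isPisot β
  obtain ⟨a, ha, hleads, hlt⟩ := hparry.exists_leads_digits hz l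
  rw [h.eq, quasiOrbit_sub_one_eq hβ.out.one_lt ha] at hlt
  have hvalue : value β (digits β z l) = gen β ^ l * z - z := by
    apply Subtype.ext
    rw [coe_value_digits (zero_le_one.trans hparry.one_lt.le) (Ico_subset_Icc_self hz), h.eq]
    push_cast
    rw [coe_gen]
  have hmem := phi_value_mem_subtile ⟨admissible_digits hparry.one_lt hz l, hleads⟩
  rw [hvalue] at hmem
  exact ⟨a, ha, hlt, by simpa only [phi_eq_phiHom, map_sub, map_mul] using hmem⟩

theorem mem_naturalExtension_of_mem_periodicPts {z : BetaField β}
    (hz : (z : ℝ) ∈ Ico (0 : ℝ) 1) (h : (z : ℝ) ∈ periodicPts (T β)) :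
    ((z : ℝ), phi β z) ∈ naturalExtension β := by
  obtain ⟨l, hl, hper⟩ := h
  let I : Set ℕ := {a | a ∈ Icc 1 (size β) ∧ (z : ℝ) < (T β)^[a - 1] 1}
  have hclosed : IsClosed (⋃ a ∈ I, subtile β a) :=
    ((finite_Icc 1 (size β)).subset fun a ha => ha.1).isClosed_biUnion fun a _ => isClosed_closure
  have hmem : ∀ j : ℕ, phi β (gen β ^ (l * j)) * phi β z - phi β z ∈ ⋃ a ∈ I, subtile β a :=
    fun j => by
      obtain ⟨a, ha, hlt, hmem⟩ := exists_sub_mem_subtile_of_isPeriodicPt hz (hper.mul_const j)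
      exact mem_biUnion (x := a) ⟨ha, hlt⟩ hmem
  have hlim : Tendsto (fun j : ℕ => phi β (gen β ^ (l * j)) * phi β z - phi β z) atTop
      (𝓝 (0 * phi β z - phi β z)) :=
    ((tendsto_phi_gen_pow.comp (tendsto_id.const_mul_atTop' hl)).mul_const _).sub_const _
  have hlim_mem := hclosed.mem_of_tendsto hlim (.of_forall hmem)
  rw [zero_mul, zero_sub] at hlim_mem
  obtain ⟨a, ⟨ha, hlt⟩, hmem⟩ := mem_iUnion₂.1 hlim_mem
  exact mem_naturalExtension_iff.2 ⟨hz.1, a, ha, hlt, hmem⟩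

theorem mem_purelyPeriodic_iff_mem_naturalExtension {z : BetaField β}
    (hz : (z : ℝ) ∈ Ico (0 : ℝ) 1) :
    (z : ℝ) ∈ purelyPeriodic β ↔ ((z : ℝ), phi β z) ∈ naturalExtension β := by
  rw [mem_purelyPeriodic_iff hβ.out.one_lt hz]
  exact ⟨mem_naturalExtension_of_mem_periodicPts hz, mem_periodicPts_of_mem_naturalExtension⟩

/-! ### Density of the rationals prime to the norm in the stripes -/

theorem normBeta_ne_zero : normBeta β ≠ 0 :=
  Algebra.norm_ne_zero_iff.2 fun h => gen_ne_zero (congrArg Subtype.val h)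

theorem natAbs_normBeta_mem (P : PrimesAbove β) :
    (((normBeta β).natAbs : ℕ) : 𝓞 (BetaField β)) ∈ P.1.asIdeal := by
  have hmem := Ideal.absNorm_mem (Ideal.span {genInt β})
  rw [Ideal.absNorm_span_singleton] at hmem
  exact (Ideal.span_singleton_le_iff_mem _).2 P.2 hmem

variable (β) in
/-- The ring `ℤ_(N(β))`. -/
def znSubring : Subring ℚ where
  carrier := ZN β
  zero_mem' := Nat.coprime_one_left _
  one_mem' := Nat.coprime_one_left _
  add_mem' {x y} hx hy := Nat.Coprime.coprime_dvd_left (Rat.add_den_dvd x y) (.mul_left hx hy)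
  mul_mem' {x y} hx hy := Nat.Coprime.coprime_dvd_left (Rat.mul_den_dvd x y) (.mul_left hx hy)
  neg_mem' hx := hx

variable (β) in
/-- The ratio `N / (N + 1)` with `N = |N(β)|`. It lies in `ℤ_(N(β))`, and its powers tend to `0` in
`ℝ` as well as at every prime ideal which contains `β`. -/
noncomputable def normRatio : ℚ := (normBeta β).natAbs / ((normBeta β).natAbs + 1)

theorem normRatio_mem_znSubring : normRatio β ∈ znSubring β := by
  have hdvd : ((normRatio β).den : ℤ) ∣ ((normBeta β).natAbs + 1 : ℕ) := by
    have h := Rat.den_dvd (normBeta β).natAbs ((normBeta β).natAbs + 1 : ℕ)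
    rwa [Rat.divInt_eq_div, Nat.cast_succ, Int.cast_add, Int.cast_natCast, Int.cast_one] at h
  exact Nat.Coprime.coprime_dvd_left (Int.natCast_dvd_natCast.1 hdvd) (by simp)

theorem normRatio_pos : 0 < normRatio β := by
  have hnorm : 0 < (normBeta β).natAbs := Int.natAbs_pos.2 normBeta_ne_zero
  unfold normRatio
  positivity

theorem normRatio_lt_one : normRatio β < 1 := by
  unfold normRatio
  rw [div_lt_one (by positivity)]
  exact lt_add_one _

theorem valued_phiFin_normRatio_lt_one (P : PrimesAbove β) :
    Valued.v (phiFin β (normRatio β : BetaField β) P) < 1 := by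
  set N := (normBeta β).natAbs
  have hN : (N : 𝓞 (BetaField β)) ∈ P.1.asIdeal := natAbs_normBeta_mem P
  have hN1 : (N + 1 : 𝓞 (BetaField β)) ∉ P.1.asIdeal := fun h =>
    P.1.isPrime.ne_top ((Ideal.eq_top_iff_one _).2 ((Ideal.add_mem_iff_right _ hN).1 h))
  have hvN : P.1.valuation (BetaField β) N < 1 := by
    simpa using (P.1.valuation_lt_one_iff_mem (K := BetaField β) _).2 hN
  have hvN1 : P.1.valuation (BetaField β) (N + 1) = 1 := by
    simpa using (P.1.valuation_eq_one_iff_notMem (K := BetaField β)).2 hN1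
  rw [valued_phiFin, normRatio]
  push_cast
  rwa [map_div₀, hvN1, div_one]

theorem tendsto_zero_of_valued_le {α R Γ₀ : Type*} [Ring R] [LinearOrderedCommGroupWithZero Γ₀]
    [Valued R Γ₀] {l : Filter α} {u w : α → R} (hw : Tendsto w l (𝓝 0))
    (h : ∀ k, Valued.v (u k) ≤ Valued.v (w k)) : Tendsto u l (𝓝 0) := by
  rw [(Valued.hasBasis_nhds_zero _ _).tendsto_right_iff] at hw ⊢
  intro γ hγ
  filter_upwards [hw γ hγ] with k hk
  exact ((Valuation.restrict_le_iff _).2 (h k)).trans_lt hk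

theorem tendsto_floor_div_pow_mul_pow {c : ℝ} (hc0 : 0 < c) (hc1 : c < 1) (r : ℝ) :
    Tendsto (fun k : ℕ => ⌊r / c ^ k⌋ * c ^ k) atTop (𝓝 r) := by
  have hpow := tendsto_pow_atTop_nhds_zero_of_lt_one hc0.le hc1
  refine tendsto_of_tendsto_of_tendsto_of_le_of_le (by simpa using hpow.const_sub r)
    tendsto_const_nhds (fun k => ?_) fun k => ?_
  · have hfloor := (div_lt_iff₀ (pow_pos hc0 k)).1 (Int.lt_floor_add_one (r / c ^ k))
    rw [add_mul, one_mul] at hfloor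
    exact (sub_lt_iff_lt_add.2 hfloor).le
  · exact (le_div_iff₀ (pow_pos hc0 k)).1 (Int.floor_le _)

theorem exists_seq_mem_ZN_tendsto (r : ℝ) {y : ℚ} (hy : y ∈ ZN β) :
    ∃ x : ℕ → ℚ, (∀ k, x k ∈ ZN β) ∧ Tendsto (fun k => (x k : ℝ)) atTop (𝓝 r) ∧
      Tendsto (fun k => phiFin β (x k : BetaField β)) atTop (𝓝 (phiFin β (y : BetaField β))) := by
  set c := normRatio β
  have hc0 : (0 : ℝ) < c := mod_cast normRatio_pos
  have hc1 : (c : ℝ) < 1 := mod_cast normRatio_lt_one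
  let m : ℕ → ℤ := fun k => ⌊(r - y) / (c : ℝ) ^ k⌋
  refine ⟨fun k => y + m k * c ^ k, fun k => ?_, ?_, tendsto_pi_nhds.2 fun P => ?_⟩
  · exact (znSubring β).add_mem hy
      (mul_mem (intCast_mem _ _) (pow_mem normRatio_mem_znSubring k))
  · push_cast
    simpa only [add_sub_cancel] using
      (tendsto_floor_div_pow_mul_pow hc0 hc1 (r - y)).const_add (y : ℝ)
  · refine tendsto_sub_nhds_zero_iff.1 (tendsto_zero_of_valued_le
      (Valued.tendsto_zero_pow_of_v_lt_one (valued_phiFin_normRatio_lt_one P)) fun k => ?_)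
    have hdiff : phiFin β ((y + m k * c ^ k : ℚ) : BetaField β) P - phiFin β (y : BetaField β) P =
        phiFin β (m k : BetaField β) P * phiFin β (c : BetaField β) P ^ k := by
      simp [phiFin]
    rw [hdiff, map_mul, valued_phiFin]
    exact mul_le_of_le_one_left' (isIntegral_iff_forall_valuation_le_one.1
      (isIntegral_algebraMap (R := ℤ) (x := m k)) P.1)

theorem continuous_diag (β : ℝ) : Continuous (diag β) := by
  unfold diag
  fun_prop

theorem phi_ratCast (x : ℚ) : phi β (x : BetaField β) = (diag β x, phiFin β x) := by
  simp [phi, phiInf, diag]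

theorem mem_of_forall_phi_mem {C : Set (KBeta β)} (hC : IsClosed C) {U : Set ℝ} (hU : IsOpen U)
    (h : ∀ x ∈ ZN β, (x : ℝ) ∈ U → phi β (x : BetaField β) ∈ C) {r : ℝ} (hr : r ∈ U) {y : ℚ}
    (hy : y ∈ ZN β) : (diag β r, phiFin β (y : BetaField β)) ∈ C := by
  obtain ⟨x, hx, hxr, hxy⟩ := exists_seq_mem_ZN_tendsto r hy
  have hlim : Tendsto (fun k => phi β (x k : BetaField β)) atTop (𝓝 (diag β r, phiFin β y)) := by
    simp only [phi_ratCast]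
    exact (((continuous_diag β).tendsto r).comp hxr).prodMk_nhds hxy
  exact hC.mem_of_tendsto hlim ((hxr.eventually (hU.mem_nhds hr)).mono fun k => h _ (hx k))

theorem stripe_subset_of_forall_phi_mem {C : Set (KBeta β)} (hC : IsClosed C) {s t : ℝ}
    (hst : s < t) (h : ∀ x ∈ ZN β, (x : ℝ) ∈ Ioo s t → phi β (x : BetaField β) ∈ C) :
    stripe β s t ⊆ C := by
  have hsub : (diag β '' Ioo s t) ×ˢ ((fun x : ℚ => phiFin β (x : BetaField β)) '' ZN β) ⊆ C := by
    rintro ⟨_, _⟩ ⟨⟨r, hr, rfl⟩, y, hy, rfl⟩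
    exact mem_of_forall_phi_mem hC isOpen_Ioo h hr hy
  refine Subset.trans ?_ (closure_minimal hsub hC)
  rw [closure_prod_eq]
  refine prod_mono ?_ subset_rfl
  rw [← closure_Ioo hst.ne]
  exact image_closure_subset_closure_image (continuous_diag β)

theorem phi_mem_stripe {x : ℚ} (hx : x ∈ ZN β) {s t : ℝ} (h : (x : ℝ) ∈ Icc s t) :
    phi β (x : BetaField β) ∈ stripe β s t := by
  rw [phi_ratCast]
  exact ⟨⟨x, h, rfl⟩, subset_closure ⟨x, hx, rfl⟩⟩

theorem stripe_mono {s t t' : ℝ} (h : t ≤ t') : stripe β s t ⊆ stripe β s t' :=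
  prod_mono (image_mono (Icc_subset_Icc_right h)) subset_rfl

/-! ### The function `γ` -/

theorem gamma_nonneg : 0 ≤ gamma β := Real.sSup_nonneg fun _ hv => hv.1.1

theorem mem_purelyPeriodic_of_lt_gamma {x : ℚ} (hx0 : 0 < (x : ℝ)) (h : (x : ℝ) < gamma β)
    (hx : x ∈ ZN β) : (x : ℝ) ∈ purelyPeriodic β := by
  by_contra hnot
  exact h.not_ge (Real.sSup_le (fun v hv => le_of_not_gt fun hxv =>
    hnot (hv.2 x (mod_cast hx0) hxv.le hx)) hx0.le)

theorem le_gamma {t : ℝ} (ht : t ≤ 1)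
    (h : ∀ x ∈ ZN β, 0 < (x : ℝ) → (x : ℝ) < t → (x : ℝ) ∈ purelyPeriodic β) : t ≤ gamma β := by
  refine le_of_forall_lt fun v hv => ?_
  rcases lt_or_ge v 0 with hv0 | hv0
  · exact hv0.trans_le gamma_nonneg
  obtain ⟨u, hvu, hut⟩ := exists_between hv
  refine hvu.trans_le (le_csSup ⟨1, fun _ h => h.1.2⟩
    ⟨⟨hv0.trans hvu.le, hut.le.trans ht⟩, fun x hx0 hxu hx => ?_⟩)
  exact h x hx (mod_cast hx0) (hxu.trans_lt hut)

theorem coe_ratCast (β : ℝ) (x : ℚ) : ((x : BetaField β) : ℝ) = x := by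
  push_cast
  rfl

theorem mem_purelyPeriodic_iff_exists_neg_phi_mem_subtile {x : ℚ} (hx : (x : ℝ) ∈ Ico 0 1) :
    (x : ℝ) ∈ purelyPeriodic β ↔ ∃ a ∈ Icc 1 (size β), (x : ℝ) < (T β)^[a - 1] 1 ∧
      -phi β (x : BetaField β) ∈ subtile β a := by
  rw [← coe_ratCast β] at hx ⊢
  rw [mem_purelyPeriodic_iff_mem_naturalExtension hx, mem_naturalExtension_iff,
    and_iff_right hx.1]

theorem gamma_eq_zero_of_forall_not_stripe_subset
    (h : ∀ η : ℝ, 0 < η → ¬ stripe β 0 η ⊆ -tile β) : gamma β = 0 := by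
  refine le_antisymm (not_lt.1 fun hpos => h _ hpos ?_) gamma_nonneg
  refine stripe_subset_of_forall_phi_mem isClosed_closure.neg hpos fun x hx hxγ => ?_
  have hpure := mem_purelyPeriodic_of_lt_gamma hxγ.1 hxγ.2 hx
  obtain ⟨a, -, -, hmem⟩ := (mem_purelyPeriodic_iff_exists_neg_phi_mem_subtile hpure.1).1 hpure
  exact subtile_subset_tile a hmem

theorem isClosed_negSubtiles (a : ℕ → ℕ) (k : ℕ) : IsClosed (negSubtiles β a k) :=
  (finite_Icc k (size β)).isClosed_biUnion fun _ _ => isClosed_closure.neg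

theorem level_of_pos (β : ℝ) (a : ℕ → ℕ) {k : ℕ} (hk : 0 < k) :
    level β a k = (T β)^[a k - 1] 1 := if_neg hk.ne'

theorem level_le_one (β : ℝ) (a : ℕ → ℕ) (k : ℕ) : level β a k ≤ 1 := by
  rw [level]
  split_ifs
  · exact zero_le_one
  · exact (T_iterate_mem_Icc β one_mem_Icc_zero_one _).2

section Level

variable {a : ℕ → ℕ} (ha : IsOrbitOrdering β a)

include ha

theorem level_pos {k : ℕ} (hk : k ∈ Icc 1 (size β)) : 0 < level β a k := by
  rw [level_of_pos β a hk.1, ← quasiOrbit_sub_one_eq hβ.out.one_lt (ha.bijOn.mapsTo hk)]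
  exact (quasiOrbit_mem_Ioc β _).1

theorem strictMonoOn_level : StrictMonoOn (level β a) (Iic (size β)) := by
  intro i hi j hj hij
  rcases i.eq_zero_or_pos with rfl | hi0
  · exact level_pos ha ⟨hij, hj⟩
  · rw [level_of_pos β a hi0, level_of_pos β a (hi0.trans hij)]
    exact ha.strictMonoOn ⟨hi0, hi⟩ ⟨hi0.trans hij, hj⟩ hij

theorem level_nonneg {k : ℕ} (hk : k ≤ size β) : 0 ≤ level β a k :=
  (strictMonoOn_level ha).monotoneOn (mem_Iic.2 (k.zero_le.trans hk)) hk k.zero_le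

theorem lt_level_iff {k : ℕ} (hk : k ∈ Icc 1 (size β)) {x : ℝ}
    (hx : x ∈ Ico (level β a (k - 1)) (level β a k)) {j : ℕ} (hj : j ≤ size β) :
    x < level β a j ↔ k ≤ j := by
  have hmono := (strictMonoOn_level ha).monotoneOn
  refine ⟨fun h => ?_, fun h => hx.2.trans_le (hmono hk.2 hj h)⟩
  by_contra! hjk
  have hk1 : k - 1 ≤ size β := (Nat.sub_le k 1).trans hk.2
  exact (hx.1.trans_lt h).not_ge (hmono hj hk1 (Nat.le_sub_one_of_lt hjk))

theorem mem_purelyPeriodic_iff_phi_mem_negSubtiles {k : ℕ} (hk : k ∈ Icc 1 (size β)) {x : ℚ}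
    (hx : (x : ℝ) ∈ Ico (level β a (k - 1)) (level β a k)) :
    (x : ℝ) ∈ purelyPeriodic β ↔ phi β (x : BetaField β) ∈ negSubtiles β a k := by
  have hx01 : (x : ℝ) ∈ Ico 0 1 :=
    ⟨(level_nonneg ha ((Nat.sub_le k 1).trans hk.2)).trans hx.1, hx.2.trans_le (level_le_one β a k)⟩
  rw [mem_purelyPeriodic_iff_exists_neg_phi_mem_subtile hx01, ← ha.bijOn.image_eq,
    exists_mem_image]
  simp only [negSubtiles, mem_iUnion₂, Set.mem_neg, exists_prop]
  refine exists_congr fun j => ⟨fun ⟨hj, hlt, hmem⟩ => ?_, fun ⟨hj, hmem⟩ => ?_⟩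
  · rw [← level_of_pos β a hj.1, lt_level_iff ha hk hx hj.2] at hlt
    exact ⟨⟨hlt, hj.2⟩, hmem⟩
  · refine ⟨⟨hk.1.trans hj.1, hj.2⟩, ?_, hmem⟩
    rw [← level_of_pos β a (hk.1.trans hj.1), lt_level_iff ha hk hx hj.2]
    exact hj.1

theorem stripe_subset_negSubtiles {k : ℕ} (hk : k ∈ Icc 1 (size β)) {t : ℝ}
    (ht : t ∈ Ioc (level β a (k - 1)) (level β a k)) (htγ : t ≤ gamma β) :
    stripe β (level β a (k - 1)) t ⊆ negSubtiles β a k := by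
  refine stripe_subset_of_forall_phi_mem (isClosed_negSubtiles a k) ht.1 fun x hx hxt => ?_
  have hx0 := (level_nonneg ha ((Nat.sub_le k 1).trans hk.2)).trans_lt hxt.1
  exact (mem_purelyPeriodic_iff_phi_mem_negSubtiles ha hk ⟨hxt.1.le, hxt.2.trans_le ht.2⟩).1
    (mem_purelyPeriodic_of_lt_gamma hx0 (hxt.2.trans_le htγ) hx)

theorem le_gamma_of_stripe_subset {k : ℕ} (hk : k ∈ Icc 1 (size β)) {t : ℝ}
    (hγ : level β a (k - 1) ≤ gamma β) (ht : t ≤ level β a k)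
    (hsub : stripe β (level β a (k - 1)) t ⊆ negSubtiles β a k) : t ≤ gamma β := by
  refine le_gamma (ht.trans (level_le_one β a k)) fun x hx hx0 hxt => ?_
  rcases lt_or_ge (x : ℝ) (level β a (k - 1)) with hlt | hge
  · exact mem_purelyPeriodic_of_lt_gamma hx0 (hlt.trans_le hγ) hx
  · exact (mem_purelyPeriodic_iff_phi_mem_negSubtiles ha hk ⟨hge, hxt.trans_le ht⟩).2
      (hsub (phi_mem_stripe hx ⟨hge, hxt.le⟩))

theorem level_le_gamma_iff {k : ℕ} (hk : k ∈ Icc 1 (size β)) :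
    level β a k ≤ gamma β ↔ level β a (k - 1) ≤ gamma β ∧
      stripe β (level β a (k - 1)) (level β a k) ⊆ negSubtiles β a k := by
  have hlt : level β a (k - 1) < level β a k :=
    strictMonoOn_level ha ((Nat.sub_le k 1).trans hk.2) hk.2 (Nat.sub_one_lt_of_lt hk.1)
  exact ⟨fun h => ⟨hlt.le.trans h, stripe_subset_negSubtiles ha hk ⟨hlt, le_rfl⟩ h⟩,
    fun h => le_gamma_of_stripe_subset ha hk h.1 le_rfl h.2⟩

theorem isGreatest_gamma {k : ℕ} (hk : k ∈ Icc 1 (size β))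
    (h : level β a (k - 1) < gamma β) (h' : gamma β ≤ level β a k) :
    IsGreatest {η : ℝ | level β a (k - 1) ≤ η ∧ η ≤ level β a k ∧
      stripe β (level β a (k - 1)) η ⊆ negSubtiles β a k} (gamma β) :=
  ⟨⟨h.le, h', stripe_subset_negSubtiles ha hk ⟨h, h'⟩ le_rfl⟩,
    fun _ hη => le_gamma_of_stripe_subset ha hk h.le hη.2.1 hη.2.2⟩

theorem isGreatest_gamma_of_lt {k : ℕ} (hk : k ∈ Icc 1 (size β))
    (h : level β a (k - 1) < gamma β) (h' : gamma β < level β a k) :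
    IsGreatest {η : ℝ | level β a (k - 1) ≤ η ∧
      stripe β (level β a (k - 1)) η ⊆ negSubtiles β a k} (gamma β) := by
  refine ⟨⟨h.le, stripe_subset_negSubtiles ha hk ⟨h, h'.le⟩ le_rfl⟩, fun η hη => ?_⟩
  refine le_gamma_of_stripe_subset ha hk h.le (le_of_not_gt fun hlt => h'.not_ge ?_) hη.2
  exact le_gamma_of_stripe_subset ha hk h.le le_rfl ((stripe_mono hlt.le).trans hη.2)

end Level

end Pisot

end PisotBeta

theorem mainTheorem10 (β : ℝ) [Fact (PisotBeta.IsPisot β)] :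
    (∃ a : ℕ → ℕ, PisotBeta.IsOrbitOrdering β a) ∧
    (∀ a : ℕ → ℕ, PisotBeta.IsOrbitOrdering β a →
      ∀ k : ℕ, 1 ≤ k → k ≤ PisotBeta.size β →
        (PisotBeta.level β a k ≤ PisotBeta.gamma β ↔
          PisotBeta.level β a (k - 1) ≤ PisotBeta.gamma β ∧
          PisotBeta.stripe β (PisotBeta.level β a (k - 1)) (PisotBeta.level β a k) ⊆
            PisotBeta.negSubtiles β a k) ∧
        (PisotBeta.level β a (k - 1) < PisotBeta.gamma β →
          PisotBeta.gamma β ≤ PisotBeta.level β a k →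
          IsLUB {η : ℝ | PisotBeta.level β a (k - 1) ≤ η ∧ η ≤ PisotBeta.level β a k ∧
            PisotBeta.stripe β (PisotBeta.level β a (k - 1)) η ⊆
              PisotBeta.negSubtiles β a k} (PisotBeta.gamma β)) ∧
        (PisotBeta.level β a (k - 1) < PisotBeta.gamma β →
          PisotBeta.gamma β < PisotBeta.level β a k →
          IsLUB {η : ℝ | PisotBeta.level β a (k - 1) ≤ η ∧
            PisotBeta.stripe β (PisotBeta.level β a (k - 1)) η ⊆
              PisotBeta.negSubtiles β a k} (PisotBeta.gamma β))) ∧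
    ((∀ η : ℝ, 0 < η → ¬ PisotBeta.stripe β 0 η ⊆ -PisotBeta.tile β) →
      PisotBeta.gamma β = 0) := by
  have hparry := PisotBeta.isParry_of_isPisot β
  exact ⟨hparry.exists_isOrbitOrdering,
    fun a ha k hk hk' => ⟨PisotBeta.level_le_gamma_iff ha ⟨hk, hk'⟩,
      fun h h' => (PisotBeta.isGreatest_gamma ha ⟨hk, hk'⟩ h h').isLUB,
      fun h h' => (PisotBeta.isGreatest_gamma_of_lt ha ⟨hk, hk'⟩ h h').isLUB⟩,
    PisotBeta.gamma_eq_zero_of_forall_not_stripe_subset⟩
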